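/- Let $(\Omega,\mathcal F,\mathbb P)$ be a probability space. For $\bullet\in\{X,I\}$ let $\mu_\bullet,m_\bullet\in\mathbb R$, $\sigma_\bullet>0$, $\lambda_\bullet\ge 0$; let $W^\bullet$ be a Brownian motion, $N^\bullet$ a homogeneous Poisson process with rate $\lambda_\bullet$, and $(U^\bullet_k)_{k\ge1}$ i.i.d. random variables with $U^\bullet_k>-1$ a.s., such that $W^\bullet$ and $N^\bullet$ are independent and $(W^\bullet,N^\bullet)$ is independent of $(U^\bullet_k)_{k\ge1}$. For $x,i>0$ let $$X_t=x\exp\Big[\Big(\mu_X-\tfrac{\sigma_X^2}{2}-\lambda_Xm_X\Big)t+\sigma_XW^X_t\Big]\prod_{k=1}^{N^X_t}(1+U^X_k),\qquad I_t=i\exp\Big[\Big(\mu_I-\tfrac{\sigma_I^2}{2}-\lambda_Im_I\Big)t+\sigma_IW^I_t\Big]\prod_{k=1}^{N^I_t}(1+U^I_k),$$ and assume that the processes $X$ and $I$ are independent. Write $\mathbb E^{(x,i)}$ for the expectation when $(X_0,I_0)=(x,i)$. Let $\kappa_1>\kappa_0>0$, $\theta>0$, $n\ge0$, $\rho\in\mathbb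 R$, put $D(y)=(\kappa_1-\kappa_0)y^\theta$, and assume that $\mathbb E[(1+U^X_1)^\theta]<\infty$ and that $$h=\rho-\Big(\mu_X+(\theta-1)\tfrac{\sigma_X^2}{2}-\lambda_Xm_X\Big)\theta-\lambda_X\Big(\mathbb E\big[(1+U^X_1)^\theta\big]-1\Big)>0 .$$ For a stopping time $\tau$ (with values in $[0,\infty]$) of the filtration generated by $(X,I)$, the performance criterion is $$J^\tau(x,i)=\mathbb E^{(x,i)}\Big[\Big\{\int_{\tau+n}^{\infty}D(X_t)e^{-\rho t}\,dt-I_\tau e^{-\rho\tau}\Big\}\mathbf 1_{\{\tau<\infty\}}\Big].$$ Then, for every such $\tau$, the integral in $J^\tau(x,i)$ converges a.s. on $\{\tau<\infty\}$, and $$J^\tau(x,i)=\mathbb E^{(x,i)}\big[e^{-\rho\tau}g(X_\tau,I_\tau)\mathbf 1_{\{\tau<\infty\}}\big],\qquad g(x,i)=(\kappa_1-\kappa_0)A\,x^\theta-i,\qquad A=\frac{e^{-hn}}{h},$$ where in both expectations the positive part of the random variable has finite expectation, so that both are well defined in $[-\infty,\infty)$. -/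

import Mathlib

open MeasureTheory ProbabilityTheory
open scoped NNReal ENNReal

/-- A homogeneous Poisson process of rate `rate` on `(Ω, P)`, as a counting process with
almost surely nondecreasing right-continuous paths.
Because the paths are nondecreasing, truncated subtraction in `ℕ` gives the true increments. -/
structure IsPoissonProcess {Ω : Type*} [MeasurableSpace Ω] (rate : ℝ≥0)
    (N : ℝ≥0 → Ω → ℕ) (P : Measure Ω) : Prop where
  measurable : ∀ t, Measurable (N t)
  zero : ∀ᵐ ω ∂P, N 0 ω = 0
  mono : ∀ᵐ ω ∂P, Monotone fun t ↦ N t ω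
  right_cont : ∀ᵐ ω ∂P, ∀ t, ContinuousWithinAt (fun s ↦ N s ω) (Set.Ici t) t
  indep_increments : HasIndepIncrements N P
  law_increment : ∀ s t : ℝ≥0, s ≤ t →
    HasLaw (fun ω ↦ N t ω - N s ω) (poissonMeasure (rate * (t - s))) P

/-- Parameters of a jump-diffusion: drift `μ`, volatility `σ`, jump rate `lam` and the
constant `m` of the compensating term `lam * m`. -/
structure JumpDiffusionParams where
  μ : ℝ
  σ : ℝ
  lam : ℝ≥0
  m : ℝ

/-- The jump-diffusion
`Y_t = y₀ exp((μ - σ²/2 - lam m) t + σ W_t) ∏_{k < N_t} (1 + U_k)`. -/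
noncomputable def jumpDiffusion {Ω : Type*} (p : JumpDiffusionParams) (y₀ : ℝ)
    (W : ℝ≥0 → Ω → ℝ) (N : ℝ≥0 → Ω → ℕ) (U : ℕ → Ω → ℝ) (t : ℝ≥0) (ω : Ω) : ℝ :=
  y₀ * Real.exp ((p.μ - p.σ ^ 2 / 2 - p.lam * p.m) * t + p.σ * W t ω)
    * ∏ k ∈ Finset.range (N t ω), (1 + U k ω)

/-- The noise driving a jump-diffusion with parameters `p`: a Brownian motion `W`, a Poisson
process `N` of rate `p.lam` and i.i.d. jump sizes `U k > -1`; `W` and `N` are independent of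
each other, and the pair of them is independent of the sequence `U`. -/
structure IsJumpDiffusionNoise {Ω : Type*} [MeasurableSpace Ω] (p : JumpDiffusionParams)
    (W : ℝ≥0 → Ω → ℝ) (N : ℝ≥0 → Ω → ℕ) (U : ℕ → Ω → ℝ) (P : Measure Ω) : Prop where
  vol_pos : 0 < p.σ
  measurable_W : ∀ t, Measurable (W t)
  brownian : IsBrownianReal W P
  poisson : IsPoissonProcess p.lam N P
  measurable_U : ∀ k, Measurable (U k)
  indep_U : iIndepFun U P
  identDistrib_U : ∀ k, IdentDistrib (U k) (U 0) P P
  neg_one_lt_U : ∀ k, ∀ᵐ ω ∂P, -1 < U k ω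
  indep_W_N : IndepFun (fun ω t ↦ W t ω) (fun ω t ↦ N t ω) P
  indep_WN_U : IndepFun (fun ω ↦ ((fun t ↦ W t ω), (fun t ↦ N t ω))) (fun ω k ↦ U k ω) P

theorem IsJumpDiffusionNoise.measurable_jumpDiffusion {Ω : Type*} [MeasurableSpace Ω]
    {p : JumpDiffusionParams} {W : ℝ≥0 → Ω → ℝ} {N : ℝ≥0 → Ω → ℕ} {U : ℕ → Ω → ℝ}
    {P : Measure Ω} (h : IsJumpDiffusionNoise p W N U P) (y₀ : ℝ) (t : ℝ≥0) :
    Measurable (jumpDiffusion p y₀ W N U t) := by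
  have hW := h.measurable_W t
  have hprod : Measurable fun ω ↦ ∏ k ∈ Finset.range (N t ω), (1 + U k ω) := by
    have h2 : Measurable fun q : ℕ × Ω ↦ ∏ k ∈ Finset.range q.1, (1 + U k q.2) :=
      measurable_from_prod_countable_right fun n ↦
        show Measurable fun ω ↦ ∏ k ∈ Finset.range n, (1 + U k ω) from
          Finset.measurable_prod _ fun k _ ↦ (h.measurable_U k).const_add 1
    exact h2.comp ((h.poisson.measurable t).prodMk measurable_id)
  unfold jumpDiffusion
  fun_prop

/-- The filtration generated by the two-dimensional process `(X, I)`. -/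
def pairFiltration {Ω : Type*} [mΩ : MeasurableSpace Ω] (X I : ℝ≥0 → Ω → ℝ)
    (hX : ∀ t, Measurable (X t)) (hI : ∀ t, Measurable (I t)) : Filtration ℝ≥0 mΩ :=
  Filtration.natural (fun t ω ↦ (X t ω, I t ω))
    fun t ↦ ((hX t).prodMk (hI t)).stronglyMeasurable

/-- The expectation `E[Z⁺] - E[Z⁻]`, with values in the extended reals; it is meaningful as
soon as `E[Z⁺]` or `E[Z⁻]` is finite, and is the usual expectation for integrable `Z`. -/
noncomputable def extExpectation {Ω : Type*} [MeasurableSpace Ω] (P : Measure Ω)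
    (Z : Ω → ℝ) : EReal :=
  ((∫⁻ ω, ENNReal.ofReal (Z ω) ∂P : ℝ≥0∞) : EReal)
    - ((∫⁻ ω, ENNReal.ofReal (-Z ω) ∂P : ℝ≥0∞) : EReal)

/-- The profit difference `D(x) = (κ₁ - κ₀) x ^ θ`. -/
noncomputable def profitDiff (κ₀ κ₁ θ x : ℝ) : ℝ := (κ₁ - κ₀) * x ^ θ

/-- The random variable
`{∫_{τ+n}^∞ D(X_t) e^{-ρ t} dt - I_τ e^{-ρ τ}} 1_{τ < ∞}`. -/
noncomputable def investmentPayoff {Ω : Type*} (κ₀ κ₁ θ ρ n : ℝ) (X I : ℝ≥0 → Ω → ℝ)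
    (τ : Ω → WithTop ℝ≥0) : Ω → ℝ :=
  Set.indicator {ω | τ ω < ⊤} fun ω ↦
    (∫ t in Set.Ioi (((τ ω).untopA : ℝ) + n),
        profitDiff κ₀ κ₁ θ (X t.toNNReal ω) * Real.exp (-ρ * t))
      - stoppedValue I τ ω * Real.exp (-ρ * (τ ω).untopA)

/-- The performance criterion `J^τ`, the expectation of `investmentPayoff`. -/
noncomputable def performanceCriterion {Ω : Type*} [MeasurableSpace Ω] (P : Measure Ω)
    (κ₀ κ₁ θ ρ n : ℝ) (X I : ℝ≥0 → Ω → ℝ) (τ : Ω → WithTop ℝ≥0) : EReal :=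
  extExpectation P (investmentPayoff κ₀ κ₁ θ ρ n X I τ)

/-- `h = ρ - (μ + (θ - 1) σ²/2 - lam m) θ - lam (E[(1 + U)^θ] - 1)`, where `U` is a jump size. -/
noncomputable def effectiveRate {Ω : Type*} [MeasurableSpace Ω] (P : Measure Ω)
    (p : JumpDiffusionParams) (ρ θ : ℝ) (U : Ω → ℝ) : ℝ :=
  ρ - (p.μ + (θ - 1) * (p.σ ^ 2 / 2) - p.lam * p.m) * θ
    - p.lam * ((∫ ω, (1 + U ω) ^ θ ∂P) - 1)

/-- `A = e^{-h n} / h`. -/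
noncomputable def constA (h n : ℝ) : ℝ := Real.exp (-h * n) / h

/-- `g(x, i) = (κ₁ - κ₀) A x ^ θ - i`. -/
noncomputable def gainFun (κ₀ κ₁ θ A x i : ℝ) : ℝ := (κ₁ - κ₀) * A * x ^ θ - i

/-- The random variable `e^{-ρ τ} g(X_τ, I_τ) 1_{τ < ∞}`. -/
noncomputable def stoppedGain {Ω : Type*} (κ₀ κ₁ θ ρ A : ℝ) (X I : ℝ≥0 → Ω → ℝ)
    (τ : Ω → WithTop ℝ≥0) : Ω → ℝ :=
  Set.indicator {ω | τ ω < ⊤} fun ω ↦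
    Real.exp (-ρ * (τ ω).untopA) * gainFun κ₀ κ₁ θ A (stoppedValue X τ ω) (stoppedValue I τ ω)

/-! The identity rests on one martingale. By the Gaussian moment generating function and the Poisson
generating function, the moment of order `θ` of `X` grows exactly at rate `ρ - h`, so `M_t = X_t ^ θ
e^{-(ρ-h)t}` is a martingale and the discounted profit is `(κ₁ - κ₀) M_t e^{-ht}`. No strong Markov
property is needed. Tonelli turns the expected integral over `t > τ + n` into an integral over `t`
of expectations on `{τ < t - n}`. On that event optional stopping replaces `M_t` by `M_τ`
(`Martingale.setLIntegral_stoppedValue_lt`). Tonelli backwards leaves the integral of `e^{-ht}` over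
`t > τ + n`, which is `e^{-hτ} A`; this is `Martingale.setLIntegral_Ioi_stopping`.

The martingale property has two difficulties. First, the jump sizes used before time `s` are random
in number. On `{N_s = j}` the past of `X` depends only on the noise up to `s` and the first `j` jump
sizes, while `X_t / X_s` depends on the later increments and the jump sizes from index `j` on; these
are independent, and summing over `j` gives the conditional moment
(`setLIntegral_rpow_jumpDiffusion`). Second, the filtration also contains `I`, and only the
processes `X` and `I` are assumed independent, not their noises. So the identity is first obtained
on the σ-algebra of `X` alone and then carried over to the join with the path of `I` by a π-system
argument (`setLIntegral_eq_of_indep_sup`).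

The cost `I_τ e^{-ρτ}` is common to both sides and may have infinite expectation. It is never
computed: the profit part has finite expectation, so it can be separated in the extended reals
(`extExpectation_of_ae_eq_sub`). -/

/-! ### Independence of the past of the noise from its future. -/

/-- Regrouping of independent pairs: if `(a, a')` is independent of `(b, b')`, `a` of `a'` and
`b` of `b'`, then `(a, b)` is independent of `(a', b')`. -/
theorem ProbabilityTheory.IndepFun.prodMk_prodMk {Ω α α' β β' : Type*} [MeasurableSpace Ω]
    [MeasurableSpace α] [MeasurableSpace α'] [MeasurableSpace β] [MeasurableSpace β']
    {P : Measure Ω} [IsProbabilityMeasure P] {a : Ω → α} {a' : Ω → α'} {b : Ω → β} {b' : Ω → β'}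
    (ha : Measurable a) (ha' : Measurable a') (hb : Measurable b) (hb' : Measurable b')
    (haa : IndepFun a a' P) (hbb : IndepFun b b' P)
    (hab : IndepFun (fun ω ↦ (a ω, a' ω)) (fun ω ↦ (b ω, b' ω)) P) :
    IndepFun (fun ω ↦ (a ω, b ω)) (fun ω ↦ (a' ω, b' ω)) P := by
  have hab1 : IndepFun a b P := hab.comp measurable_fst measurable_fst
  have hab2 : IndepFun a' b' P := hab.comp measurable_snd measurable_snd
  have e0 := (indepFun_iff_map_prod_eq_prod_map_map (ha.prodMk ha').aemeasurable
    (hb.prodMk hb').aemeasurable).1 hab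
  have e1 := (indepFun_iff_map_prod_eq_prod_map_map ha.aemeasurable ha'.aemeasurable).1 haa
  have e2 := (indepFun_iff_map_prod_eq_prod_map_map hb.aemeasurable hb'.aemeasurable).1 hbb
  have e3 := (indepFun_iff_map_prod_eq_prod_map_map ha.aemeasurable hb.aemeasurable).1 hab1
  have e4 := (indepFun_iff_map_prod_eq_prod_map_map ha'.aemeasurable hb'.aemeasurable).1 hab2
  rw [indepFun_iff_map_prod_eq_prod_map_map (ha.prodMk hb).aemeasurable
    (ha'.prodMk hb').aemeasurable, e3, e4]
  have := Measure.isProbabilityMeasure_map (μ := P) ha.aemeasurable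
  have := Measure.isProbabilityMeasure_map (μ := P) ha'.aemeasurable
  have := Measure.isProbabilityMeasure_map (μ := P) hb.aemeasurable
  have := Measure.isProbabilityMeasure_map (μ := P) hb'.aemeasurable
  refine Measure.ext_of_lintegral _ fun f hf ↦ ?_
  have hperm : ∫⁻ z, f z ∂(P.map fun ω ↦ ((a ω, b ω), (a' ω, b' ω)))
      = ∫⁻ z : (α × α') × (β × β'), f ((z.1.1, z.2.1), (z.1.2, z.2.2))
          ∂(P.map fun ω ↦ ((a ω, a' ω), (b ω, b' ω))) := by
    rw [lintegral_map hf (by fun_prop), lintegral_map (by fun_prop) (by fun_prop)]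
  rw [hperm, e0, e1, e2, lintegral_prod _ (by fun_prop), lintegral_prod _ (by fun_prop),
    lintegral_prod _ (by fun_prop), lintegral_prod _ (by fun_prop)]
  refine lintegral_congr fun x ↦ ?_
  have hx (x' : α') : ∫⁻ y : β × β', f ((x, y.1), (x', y.2)) ∂((P.map b).prod (P.map b'))
      = ∫⁻ y, ∫⁻ y', f ((x, y), (x', y')) ∂(P.map b') ∂(P.map b) :=
    lintegral_prod _ (Measurable.aemeasurable (by fun_prop))
  simp only [hx]
  -- Both sides are iterated integrals against the four marginals; they differ only in the order of
  -- the integrations over `a'` and `b`.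
  rw [lintegral_lintegral_swap (Measurable.aemeasurable
    (Measurable.lintegral_prod_right' (f := fun z : (α' × β) × β' ↦
      f ((x, z.1.2), (z.1.1, z.2))) (by fun_prop)))]
  refine lintegral_congr fun y ↦ ?_
  rw [lintegral_prod _ (by fun_prop)]

/-- The values of an increasing process with independent increments at finitely many times up to
`s` are independent of the increment after `s`. -/
theorem IsPoissonProcess.indepFun_fin_sub {Ω : Type*} [MeasurableSpace Ω] {rate : ℝ≥0}
    {N : ℝ≥0 → Ω → ℕ} {P : Measure Ω} (hN : IsPoissonProcess rate N P)
    {t : ℕ → ℝ≥0} (ht : Monotone t) (ht0 : t 0 = 0) (k : ℕ) :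
    IndepFun (fun ω (i : Finset.range (k + 1)) ↦ N (t i) ω)
      (fun ω ↦ N (t (k + 1)) ω - N (t k) ω) P := by
  have h1 := (hN.indep_increments.nat ht).indepFun_finset (Finset.range k) {k} (by simp)
    (fun i ↦ (hN.measurable _).sub (hN.measurable _))
  -- Values are recovered from increments by telescoping from `N 0 = 0`; almost sure monotonicity
  -- makes the truncated subtractions exact.
  have h2 := h1.comp
    (φ := fun (x : Finset.range k → ℕ) (i : Finset.range (k + 1)) ↦
      ∑ l : Finset.range k, if (l : ℕ) < i then x l else 0)
    (by
      refine measurable_pi_lambda _ fun i ↦ Finset.measurable_sum _ fun l _ ↦ ?_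
      split_ifs <;> fun_prop)
    (show Measurable fun x : ({k} : Finset ℕ) → ℕ ↦ x ⟨k, by simp⟩ from measurable_pi_apply _)
  refine h2.congr ?_ .rfl
  filter_upwards [hN.zero, hN.mono] with ω h0 hm
  funext i
  have hi : (i : ℕ) ≤ k := Nat.lt_succ_iff.1 (Finset.mem_range.1 i.2)
  have := Finset.sum_range_tsub (f := fun l ↦ N (t l) ω) (fun a b hab ↦ hm (ht hab)) i
  simp only [Function.comp]
  rw [Finset.univ_eq_attach, Finset.sum_attach (Finset.range k)
    (fun l ↦ if l < (i : ℕ) then N (t (l + 1)) ω - N (t l) ω else 0), ← Finset.sum_filter]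
  have hf : (Finset.range k).filter (· < (i : ℕ)) = Finset.range i := by
    ext l; simp; omega
  rw [hf, this, ht0, h0, Nat.sub_zero]

/-- The past of a Poisson process up to time `s` is independent of the increments after `s`. -/
theorem IsPoissonProcess.indepFun_past_sub {Ω : Type*} [MeasurableSpace Ω] {rate : ℝ≥0}
    {N : ℝ≥0 → Ω → ℕ} {P : Measure Ω} [IsProbabilityMeasure P] (hN : IsPoissonProcess rate N P)
    {s t : ℝ≥0} (hst : s ≤ t) :
    IndepFun (fun ω (u : Set.Iic s) ↦ N u ω) (fun ω ↦ N t ω - N s ω) P := by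
  refine IndepFun.process_indepFun (fun u ↦ hN.measurable _)
    ((hN.measurable _).sub (hN.measurable _)) fun I ↦ ?_
  -- With `0` and `s` added, the increasing enumeration starts at `0` and ends at `s`; continuing it
  -- by `t` makes the last increment the one from `s` to `t`.
  set J : Finset ℝ≥0 := insert 0 (insert s (I.image Subtype.val)) with hJ
  have hJs : ∀ u ∈ J, u ≤ s := by
    intro u hu
    simp only [hJ, Finset.mem_insert, Finset.mem_image] at hu
    rcases hu with rfl | rfl | ⟨v, _, rfl⟩
    · exact zero_le
    · exact le_rfl
    · exact v.2
  obtain ⟨k, hk⟩ : ∃ k, J.card = k + 1 :=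
    Nat.exists_eq_succ_of_ne_zero (Finset.card_ne_zero_of_mem (Finset.mem_insert_self _ _))
  set e := J.orderEmbOfFin hk with he
  have hmem : ∀ u ∈ J, ∃ i, e i = u := fun u hu ↦ by
    have : u ∈ Set.range e := by rw [he, Finset.range_orderEmbOfFin]; exact hu
    exact this
  have heJ : ∀ i, e i ∈ J := fun i ↦ Finset.orderEmbOfFin_mem _ _ _
  let T : ℕ → ℝ≥0 := fun i ↦ if h : i < k + 1 then e ⟨i, h⟩ else t
  have hTmono : Monotone T := by
    intro i j hij
    simp only [T]
    split_ifs with h1 h2 h2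
    · exact e.monotone hij
    · exact (hJs _ (heJ _)).trans hst
    · omega
    · exact le_rfl
  have hT0 : T 0 = 0 := by
    obtain ⟨i, hi⟩ := hmem 0 (Finset.mem_insert_self _ _)
    have : T 0 ≤ e i := by
      simp only [T, Nat.zero_lt_succ, dif_pos]
      exact e.monotone (Fin.zero_le i)
    exact le_antisymm (this.trans hi.le) zero_le
  have hTk : T k = s := by
    obtain ⟨i, hi⟩ := hmem s (by simp [hJ])
    have hT : T k = e (Fin.last k) := by simp [T, Fin.last]
    refine le_antisymm (hT ▸ hJs _ (heJ _)) ?_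
    rw [hT, ← hi]
    exact e.monotone (Fin.le_last i)
  have hTk1 : T (k + 1) = t := by simp [T]
  have key := hN.indepFun_fin_sub hTmono hT0 k
  rw [hTk, hTk1] at key
  have hidx : ∀ u : I, ∃ i : Finset.range (k + 1), T i = (u : Set.Iic s) := by
    intro u
    obtain ⟨i, hi⟩ := hmem (u : Set.Iic s)
      (by rw [hJ]; exact Finset.mem_insert_of_mem (Finset.mem_insert_of_mem
            (Finset.mem_image_of_mem _ u.2)))
    exact ⟨⟨i, Finset.mem_range.2 i.2⟩, by simp only [T, i.2, dif_pos, Fin.eta, hi]⟩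
  choose idx hidx using hidx
  have := key.comp (φ := fun x (u : I) ↦ x (idx u)) (ψ := id) (by fun_prop) measurable_id
  simpa only [Function.comp_def, hidx, id] using this

/-- The first `j` terms of an independent sequence are independent of the remaining ones. -/
theorem ProbabilityTheory.iIndepFun.indepFun_head_tail {Ω E : Type*} [MeasurableSpace Ω]
    [MeasurableSpace E] {P : Measure Ω} {U : ℕ → Ω → E}
    (hU : iIndepFun U P) (hm : ∀ k, Measurable (U k)) (j : ℕ) :
    IndepFun (fun ω (k : Finset.range j) ↦ U k ω) (fun ω k ↦ U (j + k) ω) P := by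
  have := hU.isProbabilityMeasure
  refine IndepFun.indepFun_process (measurable_pi_lambda _ fun _ ↦ hm _) (fun _ ↦ hm _) fun I ↦ ?_
  have hdisj : Disjoint (Finset.range j) (I.image (j + ·)) := by
    rw [Finset.disjoint_left]
    intro a ha hb
    simp at ha hb
    omega
  have h := hU.indepFun_finset _ _ hdisj hm
  exact h.comp (φ := id) (ψ := fun x (k : I) ↦ x ⟨j + k, Finset.mem_image_of_mem _ k.2⟩)
    measurable_id (by fun_prop)

namespace IsJumpDiffusionNoise

variable {Ω : Type*} [MeasurableSpace Ω] {p : JumpDiffusionParams}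
  {W : ℝ≥0 → Ω → ℝ} {N : ℝ≥0 → Ω → ℕ} {U : ℕ → Ω → ℝ} {P : Measure Ω}

theorem indepFun_past_sub_W (hn : IsJumpDiffusionNoise p W N U P) {s t : ℝ≥0} (hst : s ≤ t) :
    IndepFun (fun ω (u : Set.Iic s) ↦ W u ω) (fun ω ↦ W t ω - W s ω) P := by
  have h := (hn.brownian.indepFun_shift s).symm.comp
    measurable_id
    (show Measurable fun x : ℝ≥0 → ℝ ↦ x (t - s) from measurable_pi_apply _)
  simpa only [Function.comp_def, id, add_tsub_cancel_of_le hst] using h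

variable [IsProbabilityMeasure P]

/-- The noise up to time `s`, with the first `j` jump sizes, is independent of the increments of
the noise after `s` and of the other jump sizes. -/
theorem indepFun_past_future (hn : IsJumpDiffusionNoise p W N U P) {s t : ℝ≥0} (hst : s ≤ t)
    (j : ℕ) :
    IndepFun
      (fun ω ↦ (((fun u : Set.Iic s ↦ W u ω), (fun u : Set.Iic s ↦ N u ω)),
        (fun k : Finset.range j ↦ U k ω)))
      (fun ω ↦ ((W t ω - W s ω, N t ω - N s ω), (fun k ↦ U (j + k) ω))) P := by
  have mW : ∀ u, Measurable (W u) := hn.measurable_W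
  have mN : ∀ u, Measurable (N u) := hn.poisson.measurable
  have mU : ∀ u, Measurable (U u) := hn.measurable_U
  have mWp : Measurable (fun ω (u : Set.Iic s) ↦ W u ω) := measurable_pi_lambda _ fun _ ↦ mW _
  have mNp : Measurable (fun ω (u : Set.Iic s) ↦ N u ω) := measurable_pi_lambda _ fun _ ↦ mN _
  have mWf : Measurable (fun ω ↦ W t ω - W s ω) := (mW t).sub (mW s)
  have mNf : Measurable (fun ω ↦ N t ω - N s ω) := (mN t).sub (mN s)
  have hWN := IndepFun.prodMk_prodMk mWp mWf mNp mNf (hn.indepFun_past_sub_W hst)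
    (hn.poisson.indepFun_past_sub hst)
    (hn.indep_W_N.comp
      (φ := fun w ↦ ((fun u : Set.Iic s ↦ w u), w t - w s))
      (ψ := fun w ↦ ((fun u : Set.Iic s ↦ w u), w t - w s)) (by fun_prop)
      ((by fun_prop : Measurable fun (w : ℝ≥0 → ℕ) (u : Set.Iic s) ↦ w u).prodMk
        ((measurable_pi_apply t).sub (measurable_pi_apply s))))
  refine IndepFun.prodMk_prodMk (mWp.prodMk mNp) (mWf.prodMk mNf)
    (measurable_pi_lambda _ fun _ ↦ mU _) (measurable_pi_lambda _ fun _ ↦ mU _) hWN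
    (hn.indep_U.indepFun_head_tail mU j) ?_
  refine hn.indep_WN_U.comp
    (φ := fun w ↦ (((fun u : Set.Iic s ↦ w.1 u), (fun u : Set.Iic s ↦ w.2 u)),
      (w.1 t - w.1 s, w.2 t - w.2 s)))
    (ψ := fun v ↦ ((fun k : Finset.range j ↦ v k), (fun k ↦ v (j + k)))) ?_ (by fun_prop)
  refine Measurable.prodMk (by fun_prop) (Measurable.prodMk (by fun_prop) ?_)
  exact ((measurable_pi_apply t).comp measurable_snd).sub
    ((measurable_pi_apply s).comp measurable_snd)

end IsJumpDiffusionNoise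

/-! ### Moments of order `θ` of the increments. -/

theorem lintegral_pow_poissonMeasure (r : ℝ≥0) {m : ℝ} (hm : 0 ≤ m) :
    ∫⁻ n, ENNReal.ofReal m ^ n ∂(poissonMeasure r) = ENNReal.ofReal (Real.exp (r * (m - 1))) := by
  rw [lintegral_countable']
  have h1 (n : ℕ) : ENNReal.ofReal m ^ n * poissonMeasure r {n}
      = ENNReal.ofReal (Real.exp (-r) * ((r * m) ^ n / n.factorial)) := by
    rw [poissonMeasure_singleton, ← ENNReal.ofReal_pow hm, ← ENNReal.ofReal_mul (by positivity)]
    congr 1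
    rw [mul_pow]
    ring
  have hs : HasSum (fun n : ℕ ↦ ((r * m : ℝ)) ^ n / n.factorial) (Real.exp (r * m)) := by
    rw [Real.exp_eq_exp_ℝ]
    exact NormedSpace.expSeries_div_hasSum_exp (r * m : ℝ)
  simp_rw [h1]
  rw [← ENNReal.ofReal_tsum_of_nonneg (fun n ↦ by positivity) (hs.summable.mul_left _),
    tsum_mul_left, hs.tsum_eq, ← Real.exp_add]
  congr 2
  ring

/-- The moment of a Poisson number of independent factors with common mean `m`. -/
theorem lintegral_prod_range_poisson {Ω : Type*} [MeasurableSpace Ω] {P : Measure Ω}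
    [IsProbabilityMeasure P] {K : Ω → ℕ} {V : ℕ → Ω → ℝ≥0∞} {r : ℝ≥0} {m : ℝ} (hm : 0 ≤ m)
    (hK : HasLaw K (poissonMeasure r) P) (hKm : Measurable K) (hV : iIndepFun V P)
    (hVm : ∀ k, Measurable (V k)) (hVi : ∀ k, ∫⁻ ω, V k ω ∂P = ENNReal.ofReal m)
    (hKV : IndepFun K (fun ω k ↦ V k ω) P) :
    ∫⁻ ω, ∏ k ∈ Finset.range (K ω), V k ω ∂P = ENNReal.ofReal (Real.exp (r * (m - 1))) := by
  have mV : Measurable fun ω k ↦ V k ω := measurable_pi_lambda _ hVm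
  have e := (indepFun_iff_map_prod_eq_prod_map_map hKm.aemeasurable mV.aemeasurable).1 hKV
  have hf : Measurable fun q : ℕ × (ℕ → ℝ≥0∞) ↦ ∏ k ∈ Finset.range q.1, q.2 k :=
    measurable_from_prod_countable_right fun n ↦
      show Measurable fun v : ℕ → ℝ≥0∞ ↦ ∏ k ∈ Finset.range n, v k from
      Finset.measurable_prod _ fun k _ ↦ measurable_pi_apply k
  have := Measure.isProbabilityMeasure_map (μ := P) mV.aemeasurable
  calc ∫⁻ ω, ∏ k ∈ Finset.range (K ω), V k ω ∂P
      = ∫⁻ q, ∏ k ∈ Finset.range q.1, q.2 k ∂(P.map fun ω ↦ (K ω, fun k ↦ V k ω)) := by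
        rw [lintegral_map hf (hKm.prodMk mV)]
    _ = ∫⁻ n, ∫⁻ v : ℕ → ℝ≥0∞, ∏ k ∈ Finset.range n, v k ∂(P.map fun ω k ↦ V k ω)
          ∂(poissonMeasure r) := by
        rw [e, lintegral_prod _ hf.aemeasurable, hK.map_eq]
    _ = ∫⁻ n, ENNReal.ofReal m ^ n ∂(poissonMeasure r) := by
        refine lintegral_congr fun n ↦ ?_
        rw [lintegral_map (Finset.measurable_prod _ fun k _ ↦ measurable_pi_apply k) mV,
          lintegral_prod_eq_prod_lintegral_of_indepFun _ _ hV hVm]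
        simp [hVi]
    _ = _ := lintegral_pow_poissonMeasure r hm

theorem lintegral_exp_mul_of_hasLaw_gaussianReal {Ω : Type*} [MeasurableSpace Ω] {P : Measure Ω}
    {Z : Ω → ℝ} {v : ℝ≥0} (hZ : HasLaw Z (gaussianReal 0 v) P) (c : ℝ) :
    ∫⁻ ω, ENNReal.ofReal (Real.exp (c * Z ω)) ∂P = ENNReal.ofReal (Real.exp (v * c ^ 2 / 2)) := by
  rw [hZ.lintegral_comp (f := fun z ↦ ENNReal.ofReal (Real.exp (c * z))) (by fun_prop),
    ← ofReal_integral_eq_lintegral_ofReal (integrable_exp_mul_gaussianReal c)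
      (Filter.Eventually.of_forall fun _ ↦ (Real.exp_pos _).le)]
  have h := mgf_gaussianReal (p := gaussianReal 0 v) (X := id) (μ := 0) (v := v) (by simp) c
  simp only [mgf, id] at h
  rw [h]
  simp

/-- The exponential growth rate of the moment of order `θ` of a jump-diffusion, where `m` is the
moment of order `θ` of a jump factor. -/
noncomputable def JumpDiffusionParams.momentRate (p : JumpDiffusionParams) (θ m : ℝ) : ℝ :=
  θ * (p.μ - p.σ ^ 2 / 2 - p.lam * p.m) + (θ * p.σ) ^ 2 / 2 + p.lam * (m - 1)

/-- The origin of `h`: the drift correction `-θσ²/2` and the Gaussian exponent `(θσ)²/2` add up to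
`θ(θ - 1)σ²/2`. -/
theorem momentRate_eq_sub_effectiveRate {Ω : Type*} [MeasurableSpace Ω] (P : Measure Ω)
    (p : JumpDiffusionParams) (ρ θ : ℝ) (U : Ω → ℝ) :
    p.momentRate θ (∫ ω, (1 + U ω) ^ θ ∂P) = ρ - effectiveRate P p ρ θ U := by
  unfold JumpDiffusionParams.momentRate effectiveRate
  ring

namespace IsJumpDiffusionNoise

variable {Ω : Type*} [MeasurableSpace Ω] {p : JumpDiffusionParams}
  {W : ℝ≥0 → Ω → ℝ} {N : ℝ≥0 → Ω → ℕ} {U : ℕ → Ω → ℝ} {P : Measure Ω}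

theorem ofReal_rpow_jumpDiffusion (hn : IsJumpDiffusionNoise p W N U P) {x : ℝ} (hx : 0 < x)
    (θ : ℝ) : ∀ᵐ ω ∂P, ∀ t, ENNReal.ofReal (jumpDiffusion p x W N U t ω ^ θ)
      = ENNReal.ofReal (x ^ θ)
        * ENNReal.ofReal (Real.exp (θ * ((p.μ - p.σ ^ 2 / 2 - p.lam * p.m) * t + p.σ * W t ω)))
        * ∏ k ∈ Finset.range (N t ω), ENNReal.ofReal ((1 + U k ω) ^ θ) := by
  filter_upwards [ae_all_iff.2 hn.neg_one_lt_U] with ω hU t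
  have h1 : ∀ k, 0 ≤ 1 + U k ω := fun k ↦ by linarith [hU k]
  have h2 : 0 ≤ ∏ k ∈ Finset.range (N t ω), (1 + U k ω) := Finset.prod_nonneg fun k _ ↦ h1 k
  unfold jumpDiffusion
  rw [Real.mul_rpow (by positivity) h2, Real.mul_rpow hx.le (Real.exp_pos _).le,
    ← Real.finsetProd_rpow _ _ fun k _ ↦ h1 k, ← Real.exp_mul,
    ENNReal.ofReal_mul (by positivity), ENNReal.ofReal_mul (by positivity),
    ENNReal.ofReal_prod_of_nonneg fun k _ ↦ Real.rpow_nonneg (h1 k) _, mul_comm _ θ]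

theorem lintegral_ofReal_rpow_jump (hn : IsJumpDiffusionNoise p W N U P) {θ : ℝ}
    (hInt : Integrable (fun ω ↦ (1 + U 0 ω) ^ θ) P) (k : ℕ) :
    ∫⁻ ω, ENNReal.ofReal ((1 + U k ω) ^ θ) ∂P = ENNReal.ofReal (∫ ω, (1 + U 0 ω) ^ θ ∂P) := by
  have h := ((hn.identDistrib_U k).comp
    (u := fun y ↦ ENNReal.ofReal ((1 + y) ^ θ)) (by fun_prop)).lintegral_eq
  simp only [Function.comp_def] at h
  rw [h, ofReal_integral_eq_lintegral_ofReal hInt]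
  filter_upwards [hn.neg_one_lt_U 0] with ω hω
  exact Real.rpow_nonneg (by linarith) _

theorem moment_jump_nonneg (hn : IsJumpDiffusionNoise p W N U P) (θ : ℝ) :
    0 ≤ ∫ ω, (1 + U 0 ω) ^ θ ∂P := by
  refine integral_nonneg_of_ae ?_
  filter_upwards [hn.neg_one_lt_U 0] with ω hω
  exact Real.rpow_nonneg (by linarith) _

theorem hasLaw_sub_W (hn : IsJumpDiffusionNoise p W N U P) {s t : ℝ≥0} (hst : s ≤ t) :
    HasLaw (fun ω ↦ W t ω - W s ω) (gaussianReal 0 (t - s)) P := by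
  have h := hn.brownian.hasLaw_sub t s
  have hd : nndist t.1 s.1 = t - s := by
    ext
    rw [coe_nndist, NNReal.coe_sub hst, Real.dist_eq]
    exact abs_of_nonneg (sub_nonneg.2 (NNReal.coe_le_coe.2 hst))
  rw [hd] at h
  exact h

theorem lintegral_exp_drift_add (hn : IsJumpDiffusionNoise p W N U P) {s t : ℝ≥0} (hst : s ≤ t)
    (θ a : ℝ) :
    ∫⁻ ω, ENNReal.ofReal (Real.exp (θ * (a * (t - s) + p.σ * (W t ω - W s ω)))) ∂P
      = ENNReal.ofReal (Real.exp ((θ * a + (θ * p.σ) ^ 2 / 2) * (t - s))) := by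
  have h (ω : Ω) : ENNReal.ofReal (Real.exp (θ * (a * (t - s) + p.σ * (W t ω - W s ω))))
      = ENNReal.ofReal (Real.exp (θ * (a * (t - s))))
        * ENNReal.ofReal (Real.exp ((θ * p.σ) * (W t ω - W s ω))) := by
    rw [← ENNReal.ofReal_mul (Real.exp_pos _).le, ← Real.exp_add]
    congr 2
    ring
  have mWf : Measurable (fun ω ↦ W t ω - W s ω) := (hn.measurable_W t).sub (hn.measurable_W s)
  simp_rw [h]
  rw [lintegral_const_mul _ (by fun_prop),
    lintegral_exp_mul_of_hasLaw_gaussianReal (hn.hasLaw_sub_W hst),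
    ← ENNReal.ofReal_mul (by positivity), ← Real.exp_add, NNReal.coe_sub hst]
  congr 2
  ring

/-- The increments of the Brownian motion and of the Poisson process are independent of the jump
sizes. -/
theorem indepFun_sub_sub_jump (hn : IsJumpDiffusionNoise p W N U P) (s t : ℝ≥0) (j : ℕ) :
    IndepFun (fun ω ↦ (W t ω - W s ω, N t ω - N s ω))
      (fun ω ↦ ((), fun k ↦ U (j + k) ω)) P := by
  have mφ : Measurable fun w : (ℝ≥0 → ℝ) × (ℝ≥0 → ℕ) ↦ (w.1 t - w.1 s, w.2 t - w.2 s) :=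
    Measurable.prodMk (by fun_prop)
      (((measurable_pi_apply t).comp measurable_snd).sub
        ((measurable_pi_apply s).comp measurable_snd))
  exact hn.indep_WN_U.comp mφ
    (show Measurable fun v : ℕ → ℝ ↦ ((), fun k ↦ v (j + k)) by fun_prop)

variable [IsProbabilityMeasure P]

/-- The increment of the Brownian motion is independent of the increment of the Poisson process
together with the jump sizes. -/
theorem indepFun_sub_W_sub_N_jump (hn : IsJumpDiffusionNoise p W N U P) (s t : ℝ≥0) (j : ℕ) :
    IndepFun (fun ω ↦ W t ω - W s ω)
      (fun ω ↦ (N t ω - N s ω, fun k ↦ U (j + k) ω)) P := by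
  have hWN : IndepFun (fun ω ↦ W t ω - W s ω) (fun ω ↦ N t ω - N s ω) P :=
    hn.indep_W_N.comp (show Measurable fun w : ℝ≥0 → ℝ ↦ w t - w s by fun_prop)
      (show Measurable fun w : ℝ≥0 → ℕ ↦ w t - w s from
        (measurable_pi_apply t).sub (measurable_pi_apply s))
  -- The regrouping lemma is used with the trivial variable `()` as partner of the Brownian
  -- increment.
  exact (IndepFun.prodMk_prodMk ((hn.measurable_W t).sub (hn.measurable_W s))
    ((hn.poisson.measurable t).sub (hn.poisson.measurable s)) (measurable_const (a := ()))
    (measurable_pi_lambda _ fun _ ↦ hn.measurable_U _) hWN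
    (indepFun_const_left () _) (hn.indepFun_sub_sub_jump s t j)).comp measurable_fst measurable_id

/-- After a shift by `j` the jump sizes are still i.i.d. and independent of the Poisson increment,
so this is the Poisson generating function at the moment of one jump factor. -/
theorem lintegral_prod_jump (hn : IsJumpDiffusionNoise p W N U P) {θ : ℝ}
    (hInt : Integrable (fun ω ↦ (1 + U 0 ω) ^ θ) P) {s t : ℝ≥0} (hst : s ≤ t) (j : ℕ) :
    ∫⁻ ω, ∏ k ∈ Finset.range (N t ω - N s ω), ENNReal.ofReal ((1 + U (j + k) ω) ^ θ) ∂P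
      = ENNReal.ofReal (Real.exp (p.lam * ((∫ ω, (1 + U 0 ω) ^ θ ∂P) - 1) * (t - s))) := by
  have mU : ∀ u, Measurable (U u) := hn.measurable_U
  have hNU : IndepFun (fun ω ↦ N t ω - N s ω)
      (fun ω k ↦ ENNReal.ofReal ((1 + U (j + k) ω) ^ θ)) P :=
    (hn.indepFun_sub_sub_jump s t j).comp measurable_snd
      (show Measurable fun v : Unit × (ℕ → ℝ) ↦ fun k ↦ ENNReal.ofReal ((1 + v.2 k) ^ θ) by
        fun_prop)
  have hVind : iIndepFun (fun k ω ↦ ENNReal.ofReal ((1 + U (j + k) ω) ^ θ)) P :=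
    (hn.indep_U.precomp (g := fun k ↦ j + k) (add_right_injective j)).comp
      (fun _ y ↦ ENNReal.ofReal ((1 + y) ^ θ)) fun _ ↦ by fun_prop
  rw [lintegral_prod_range_poisson (hn.moment_jump_nonneg θ) (hn.poisson.law_increment s t hst)
    ((hn.poisson.measurable t).sub (hn.poisson.measurable s))
      hVind (fun k ↦ by fun_prop) (fun k ↦ hn.lintegral_ofReal_rpow_jump hInt _) hNU,
      NNReal.coe_mul, NNReal.coe_sub hst]
  congr 2
  ring

theorem measurable_prod_range_ofReal_rpow (θ : ℝ) : Measurable fun q : ℕ × (ℕ → ℝ) ↦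
    ∏ k ∈ Finset.range q.1, ENNReal.ofReal ((1 + q.2 k) ^ θ) :=
  measurable_from_prod_countable_right fun n ↦
    show Measurable fun v : ℕ → ℝ ↦ ∏ k ∈ Finset.range n, ENNReal.ofReal ((1 + v k) ^ θ) from
    Finset.measurable_prod _ fun k _ ↦ by fun_prop

/-- The moment of order `θ` of the relative increment of a jump-diffusion between `s` and `t`,
computed with the jump sizes from index `j` on. -/
theorem lintegral_increment (hn : IsJumpDiffusionNoise p W N U P) {θ : ℝ}
    (hInt : Integrable (fun ω ↦ (1 + U 0 ω) ^ θ) P) {s t : ℝ≥0} (hst : s ≤ t) (j : ℕ) :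
    ∫⁻ ω, ENNReal.ofReal (Real.exp (θ * ((p.μ - p.σ ^ 2 / 2 - p.lam * p.m) * (t - s)
          + p.σ * (W t ω - W s ω))))
        * ∏ k ∈ Finset.range (N t ω - N s ω), ENNReal.ofReal ((1 + U (j + k) ω) ^ θ) ∂P
      = ENNReal.ofReal (Real.exp (p.momentRate θ (∫ ω, (1 + U 0 ω) ^ θ ∂P) * (t - s))) := by
  have mWf : Measurable (fun ω ↦ W t ω - W s ω) := (hn.measurable_W t).sub (hn.measurable_W s)
  have mNf : Measurable (fun ω ↦ N t ω - N s ω) :=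
    (hn.poisson.measurable t).sub (hn.poisson.measurable s)
  have mUf : Measurable (fun ω k ↦ U (j + k) ω) :=
    measurable_pi_lambda _ fun _ ↦ hn.measurable_U _
  have mexp : Measurable fun w : ℝ ↦ ENNReal.ofReal
      (Real.exp (θ * ((p.μ - p.σ ^ 2 / 2 - p.lam * p.m) * (t - s) + p.σ * w))) := by fun_prop
  have h := lintegral_mul_eq_lintegral_mul_lintegral_of_indepFun'' (mexp.comp mWf).aemeasurable
    ((measurable_prod_range_ofReal_rpow θ).comp (mNf.prodMk mUf)).aemeasurable
    ((hn.indepFun_sub_W_sub_N_jump s t j).comp mexp (measurable_prod_range_ofReal_rpow θ))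
  simp only [Function.comp_def] at h
  rw [h, hn.lintegral_exp_drift_add hst, hn.lintegral_prod_jump hInt hst,
    ← ENNReal.ofReal_mul (by positivity), ← Real.exp_add, JumpDiffusionParams.momentRate]
  congr 2
  ring

end IsJumpDiffusionNoise

/-! ### Conditional moments given the past of the jump-diffusion. -/

theorem ProbabilityTheory.IndepFun.setLIntegral_preimage_mul {Ω α β : Type*} [MeasurableSpace Ω]
    [MeasurableSpace α] [MeasurableSpace β] {P : Measure Ω} {a : Ω → α} {b : Ω → β}
    (hab : IndepFun a b P) (ha : Measurable a) (hb : Measurable b) {Q : Set α}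
    (hQ : MeasurableSet Q) {G : α → ℝ≥0∞} (hG : Measurable G) {R : β → ℝ≥0∞} (hR : Measurable R) :
    ∫⁻ ω in a ⁻¹' Q, G (a ω) * R (b ω) ∂P
      = (∫⁻ ω in a ⁻¹' Q, G (a ω) ∂P) * ∫⁻ ω, R (b ω) ∂P := by
  have hmul := lintegral_mul_eq_lintegral_mul_lintegral_of_indepFun''
    ((hG.indicator hQ).comp ha).aemeasurable (hR.comp hb).aemeasurable
    (hab.comp (hG.indicator hQ) hR)
  rw [← lintegral_indicator (ha hQ), ← lintegral_indicator (ha hQ)]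
  refine Eq.trans (lintegral_congr fun ω ↦ ?_) hmul
  by_cases h : a ω ∈ Q <;> simp [Set.indicator, h]

namespace IsJumpDiffusionNoise

variable {Ω : Type*} [MeasurableSpace Ω] {p : JumpDiffusionParams}
  {W : ℝ≥0 → Ω → ℝ} {N : ℝ≥0 → Ω → ℕ} {U : ℕ → Ω → ℝ} {P : Measure Ω}

/-- On the event of exactly `j` jumps before `s`, the σ-algebra of a jump-diffusion up to `s` is
contained, up to null sets, in that of the noise up to `s` and of the first `j` jump sizes. -/
theorem iSup_comap_jumpDiffusion_le (hn : IsJumpDiffusionNoise p W N U P) (x : ℝ) (s : ℝ≥0)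
    (j : ℕ) :
    ⨆ u ≤ s, MeasurableSpace.comap (jumpDiffusion p x W N U u) inferInstance
      ≤ eventuallyMeasurableSpace
        (MeasurableSpace.comap
          (fun ω ↦ (((fun u : Set.Iic s ↦ W u ω), (fun u : Set.Iic s ↦ N u ω)),
            (fun k : Finset.range j ↦ U k ω))) inferInstance)
        (ae (P.restrict {ω | N s ω = j})) := by
  refine iSup₂_le fun u hu ↦ ?_
  rw [← measurable_iff_comap_le]
  -- By monotonicity `N u ≤ N s = j`, so the random product runs inside the fixed range `j`, with
  -- the unused factors replaced by `1`.
  let F : ((Set.Iic s → ℝ) × (Set.Iic s → ℕ)) × (Finset.range j → ℝ) → ℝ := fun q ↦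
    x * Real.exp ((p.μ - p.σ ^ 2 / 2 - p.lam * p.m) * u + p.σ * q.1.1 ⟨u, hu⟩)
      * ∏ k : Finset.range j, if (k : ℕ) < q.1.2 ⟨u, hu⟩ then 1 + q.2 k else 1
  have hF : Measurable F := by
    refine Measurable.mul (by fun_prop) (Finset.measurable_prod _ fun k _ ↦ ?_)
    refine Measurable.ite ?_ (by fun_prop) (by fun_prop)
    exact measurableSet_lt measurable_const (by fun_prop)
  refine (hF.comp (comap_measurable _)).eventuallyMeasurable_of_eventuallyEq ?_
  filter_upwards [ae_restrict_mem ((hn.poisson.measurable s) (measurableSet_singleton j)),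
    ae_restrict_of_ae hn.poisson.mono] with ω hω hmono
  have hle : N u ω ≤ j := (hmono hu).trans (le_of_eq hω)
  simp only [Function.comp, F, jumpDiffusion]
  congr 1
  rw [Finset.univ_eq_attach, Finset.prod_attach (Finset.range j)
    (fun k ↦ if k < N u ω then 1 + U k ω else 1), ← Finset.prod_filter]
  congr 1
  ext l
  simp
  omega

/-- The moment of a jump-diffusion at time `t` on an event known at time `s`, intersected with
the event of exactly `j` jumps before `s`. -/
theorem setLIntegral_rpow_inter_jumps [IsProbabilityMeasure P]
    (hn : IsJumpDiffusionNoise p W N U P) {x : ℝ} (hx : 0 < x) {θ : ℝ}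
    (hInt : Integrable (fun ω ↦ (1 + U 0 ω) ^ θ) P) {s t : ℝ≥0} (hst : s ≤ t) {B : Set Ω}
    (hB : MeasurableSet[⨆ u ≤ s, MeasurableSpace.comap (jumpDiffusion p x W N U u) inferInstance]
      B) (j : ℕ) :
    ∫⁻ ω in B ∩ {ω | N s ω = j}, ENNReal.ofReal (jumpDiffusion p x W N U t ω ^ θ) ∂P
      = (∫⁻ ω in B ∩ {ω | N s ω = j}, ENNReal.ofReal (jumpDiffusion p x W N U s ω ^ θ) ∂P)
        * ENNReal.ofReal (Real.exp (p.momentRate θ (∫ ω, (1 + U 0 ω) ^ θ ∂P) * (t - s))) := by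
  set past := fun ω ↦ (((fun u : Set.Iic s ↦ W u ω), (fun u : Set.Iic s ↦ N u ω)),
        (fun k : Finset.range j ↦ U k ω)) with hpast
  have mpast : Measurable past :=
    ((measurable_pi_lambda _ fun _ ↦ hn.measurable_W _).prodMk
      (measurable_pi_lambda _ fun _ ↦ hn.poisson.measurable _)).prodMk
      (measurable_pi_lambda _ fun _ ↦ hn.measurable_U _)
  obtain ⟨B', ⟨S, hS, rfl⟩, hBB'⟩ := hn.iSup_comap_jumpDiffusion_le x s j B hB
  have mE : MeasurableSet {ω | N s ω = j} := (hn.poisson.measurable s) (measurableSet_singleton j)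
  have hset : (B ∩ {ω | N s ω = j} : Set Ω) =ᵐ[P] (past ⁻¹' S ∩ {ω | N s ω = j} : Set Ω) := by
    have := (ae_restrict_iff' mE).1 hBB'
    filter_upwards [this] with ω hω
    by_cases h : N s ω = j
    · have h' := hω h
      change (_ ∧ _) = (_ ∧ _)
      rw [show (ω ∈ B) = (ω ∈ past ⁻¹' S) from h']
    · exact propext ⟨fun h' ↦ absurd h'.2 h, fun h' ↦ absurd h'.2 h⟩
  -- The event `N s = j` is itself part of the past, so the whole domain of integration is a
  -- preimage under `past`.
  let Q : Set (((Set.Iic s → ℝ) × (Set.Iic s → ℕ)) × (Finset.range j → ℝ)) :=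
    S ∩ {q | q.1.2 ⟨s, Set.mem_Iic.2 le_rfl⟩ = j}
  have mQ : MeasurableSet Q := hS.inter
    ((show Measurable fun q : ((Set.Iic s → ℝ) × (Set.Iic s → ℕ)) × (Finset.range j → ℝ) ↦
      q.1.2 ⟨s, Set.mem_Iic.2 le_rfl⟩ by fun_prop) (measurableSet_singleton j))
  let G : ((Set.Iic s → ℝ) × (Set.Iic s → ℕ)) × (Finset.range j → ℝ) → ℝ≥0∞ := fun q ↦
    ENNReal.ofReal (x ^ θ) * ENNReal.ofReal
        (Real.exp (θ * ((p.μ - p.σ ^ 2 / 2 - p.lam * p.m) * s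
          + p.σ * q.1.1 ⟨s, Set.mem_Iic.2 le_rfl⟩)))
      * ∏ k : Finset.range j, ENNReal.ofReal ((1 + q.2 k) ^ θ)
  have mG : Measurable G :=
    Measurable.mul (by fun_prop) (Finset.measurable_prod _ fun k _ ↦ by fun_prop)
  let R : (ℝ × ℕ) × (ℕ → ℝ) → ℝ≥0∞ := fun q ↦
    ENNReal.ofReal (Real.exp (θ * ((p.μ - p.σ ^ 2 / 2 - p.lam * p.m) * (t - s) + p.σ * q.1.1)))
      * ∏ k ∈ Finset.range q.1.2, ENNReal.ofReal ((1 + q.2 k) ^ θ)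
  have mR : Measurable R := by
    have h1 : Measurable fun q : (ℝ × ℕ) × (ℕ → ℝ) ↦ ENNReal.ofReal
        (Real.exp (θ * ((p.μ - p.σ ^ 2 / 2 - p.lam * p.m) * (t - s) + p.σ * q.1.1))) := by
      fun_prop
    have h2 : Measurable fun q : (ℝ × ℕ) × (ℕ → ℝ) ↦ (q.1.2, q.2) := by fun_prop
    have h3 : Measurable fun q : (ℝ × ℕ) × (ℕ → ℝ) ↦
        ∏ k ∈ Finset.range q.1.2, ENNReal.ofReal ((1 + q.2 k) ^ θ) := by
      have h := (measurable_prod_range_ofReal_rpow θ).comp h2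
      exact h
    exact Measurable.fun_mul h1 h3
  have mfut : Measurable fun ω ↦ ((W t ω - W s ω, N t ω - N s ω), (fun k ↦ U (j + k) ω)) :=
    (((hn.measurable_W t).sub (hn.measurable_W s)).prodMk
      ((hn.poisson.measurable t).sub (hn.poisson.measurable s))).prodMk
      (measurable_pi_lambda _ fun _ ↦ hn.measurable_U _)
  have mQ' : MeasurableSet (past ⁻¹' Q) := mpast mQ
  have hG (ω : Ω) : G (past ω) = ENNReal.ofReal (x ^ θ) * ENNReal.ofReal
        (Real.exp (θ * ((p.μ - p.σ ^ 2 / 2 - p.lam * p.m) * s + p.σ * W s ω)))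
      * ∏ k ∈ Finset.range j, ENNReal.ofReal ((1 + U k ω) ^ θ) := by
    simp only [G, hpast]
    rw [Finset.univ_eq_attach, Finset.prod_attach (Finset.range j)
      (fun k ↦ ENNReal.ofReal ((1 + U k ω) ^ θ))]
  have h_s : ∀ᵐ ω ∂P, ω ∈ past ⁻¹' Q →
      ENNReal.ofReal (jumpDiffusion p x W N U s ω ^ θ) = G (past ω) := by
    filter_upwards [hn.ofReal_rpow_jumpDiffusion hx θ] with ω hω hQ
    have hj : N s ω = j := hQ.2
    rw [hω, hG, hj]
  -- Jumps between `s` and `t` use the sizes from index `j` on, which makes the second factor a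
  -- function of the future alone.
  have h_t : ∀ᵐ ω ∂P, ω ∈ past ⁻¹' Q →
      ENNReal.ofReal (jumpDiffusion p x W N U t ω ^ θ) = G (past ω)
        * R ((W t ω - W s ω, N t ω - N s ω), (fun k ↦ U (j + k) ω)) := by
    filter_upwards [hn.ofReal_rpow_jumpDiffusion hx θ, hn.poisson.mono] with ω hω hmono hQ
    have hj : N s ω = j := hQ.2
    have hNt : N t ω = j + (N t ω - j) := by have := hmono hst; simp only at this; omega
    have hexp : ENNReal.ofReal
        (Real.exp (θ * ((p.μ - p.σ ^ 2 / 2 - p.lam * p.m) * t + p.σ * W t ω)))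
        = ENNReal.ofReal (Real.exp (θ * ((p.μ - p.σ ^ 2 / 2 - p.lam * p.m) * s + p.σ * W s ω)))
          * ENNReal.ofReal (Real.exp (θ * ((p.μ - p.σ ^ 2 / 2 - p.lam * p.m) * (t - s)
            + p.σ * (W t ω - W s ω)))) := by
      rw [← ENNReal.ofReal_mul (by positivity), ← Real.exp_add]
      congr 2
      ring
    rw [hω, hG, hNt, Finset.prod_range_add, hexp]
    simp only [R, hj, add_tsub_cancel_left]
    ring
  have hind := hn.indepFun_past_future hst j
  rw [setLIntegral_congr hset, setLIntegral_congr hset]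
  change ∫⁻ ω in past ⁻¹' Q, _ ∂P = (∫⁻ ω in past ⁻¹' Q, _ ∂P) * _
  rw [setLIntegral_congr_fun_ae mQ' h_s, setLIntegral_congr_fun_ae mQ' h_t,
    ← hn.lintegral_increment hInt hst j]
  exact hind.setLIntegral_preimage_mul mpast mfut mQ mG mR

/-- The moment of a jump-diffusion at time `t` on an event known at time `s`. -/
theorem setLIntegral_rpow_jumpDiffusion [IsProbabilityMeasure P]
    (hn : IsJumpDiffusionNoise p W N U P) {x : ℝ} (hx : 0 < x) {θ : ℝ}
    (hInt : Integrable (fun ω ↦ (1 + U 0 ω) ^ θ) P) {s t : ℝ≥0} (hst : s ≤ t) {B : Set Ω}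
    (hB : MeasurableSet[⨆ u ≤ s, MeasurableSpace.comap (jumpDiffusion p x W N U u) inferInstance]
      B) :
    ∫⁻ ω in B, ENNReal.ofReal (jumpDiffusion p x W N U t ω ^ θ) ∂P
      = (∫⁻ ω in B, ENNReal.ofReal (jumpDiffusion p x W N U s ω ^ θ) ∂P)
        * ENNReal.ofReal (Real.exp (p.momentRate θ (∫ ω, (1 + U 0 ω) ^ θ ∂P) * (t - s))) := by
  have hle : ⨆ u ≤ s, MeasurableSpace.comap (jumpDiffusion p x W N U u) inferInstance
      ≤ ‹MeasurableSpace Ω› :=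
    iSup₂_le fun u _ ↦ (hn.measurable_jumpDiffusion x u).comap_le
  have hU : B = ⋃ j, B ∩ {ω | N s ω = j} := by ext ω; simp
  have hm : ∀ j, MeasurableSet (B ∩ {ω | N s ω = j}) := fun j ↦
    (hle B hB).inter ((hn.poisson.measurable s) (measurableSet_singleton j))
  have hd : Pairwise (Function.onFun Disjoint fun j ↦ B ∩ {ω | N s ω = j}) := by
    intro a b hab
    refine Set.disjoint_left.2 fun ω h1 h2 ↦ hab ?_
    exact h1.2.symm.trans h2.2
  have hsplit (f : Ω → ℝ≥0∞) :
      ∫⁻ ω in B, f ω ∂P = ∑' j, ∫⁻ ω in B ∩ {ω | N s ω = j}, f ω ∂P := by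
    conv_lhs => rw [hU]
    exact lintegral_iUnion hm hd f
  rw [hsplit, hsplit, ← ENNReal.tsum_mul_right]
  exact tsum_congr fun j ↦ hn.setLIntegral_rpow_inter_jumps hx hInt hst hB j

end IsJumpDiffusionNoise

/-! ### Enlargement of the filtration by an independent process. -/

theorem MeasurableSpace.generateFrom_image2_inter {Ω : Type*} (m₁ m₂ : MeasurableSpace Ω) :
    m₁ ⊔ m₂ = MeasurableSpace.generateFrom
      (Set.image2 (· ∩ ·) {s | MeasurableSet[m₁] s} {s | MeasurableSet[m₂] s}) := by
  refine le_antisymm (sup_le (fun s hs ↦ ?_) (fun s hs ↦ ?_)) ?_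
  · exact measurableSet_generateFrom ⟨s, hs, Set.univ, MeasurableSet.univ, Set.inter_univ s⟩
  · exact measurableSet_generateFrom ⟨Set.univ, MeasurableSet.univ, s, hs, Set.univ_inter s⟩
  · refine MeasurableSpace.generateFrom_le ?_
    rintro _ ⟨s, hs, t, ht, rfl⟩
    exact MeasurableSet.inter ((le_sup_left : m₁ ≤ m₁ ⊔ m₂) s hs)
      ((le_sup_right : m₂ ≤ m₁ ⊔ m₂) t ht)

/-- Two functions with the same integrals on the sets of `m₁` have the same integrals on the sets
of `m₁ ⊔ m₂`, if `m₂` is independent of `m₁` and of the two functions. -/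
theorem setLIntegral_eq_of_indep_sup {Ω : Type*} {m₁ m₂ mf : MeasurableSpace Ω}
    [mΩ : MeasurableSpace Ω] {P : Measure Ω} (hm₁ : m₁ ≤ mf) (hmf : mf ≤ mΩ) (hm₂ : m₂ ≤ mΩ)
    (hind : Indep mf m₂ P) {f g : Ω → ℝ≥0∞} (hf : Measurable[mf] f) (hg : Measurable[mf] g)
    (hfin : ∫⁻ ω, f ω ∂P ≠ ∞)
    (hfg : ∀ B, MeasurableSet[m₁] B → ∫⁻ ω in B, f ω ∂P = ∫⁻ ω in B, g ω ∂P)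
    {A : Set Ω} (hA : MeasurableSet[m₁ ⊔ m₂] A) :
    ∫⁻ ω in A, f ω ∂P = ∫⁻ ω in A, g ω ∂P := by
  have hle : m₁ ⊔ m₂ ≤ mΩ := sup_le (hm₁.trans hmf) hm₂
  have hprod : ∀ {k : Ω → ℝ≥0∞}, Measurable[mf] k → ∀ B C, MeasurableSet[m₁] B →
      MeasurableSet[m₂] C → ∫⁻ ω in B ∩ C, k ω ∂P = (∫⁻ ω in B, k ω ∂P) * P C := by
    intro k hk B C hB hC
    have h := lintegral_mul_eq_lintegral_mul_lintegral_of_independent_measurableSpace hmf hm₂ hind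
      (hk.indicator (hm₁ B hB))
      ((measurable_const (a := (1 : ℝ≥0∞))).indicator hC : Measurable[m₂] (C.indicator _))
    have hB' := hmf _ (hm₁ _ hB)
    rw [lintegral_indicator hB', lintegral_indicator (hm₂ C hC), setLIntegral_one] at h
    rw [← h, ← lintegral_indicator (hB'.inter (hm₂ _ hC))]
    refine lintegral_congr fun ω ↦ ?_
    by_cases h1 : ω ∈ B <;> by_cases h2 : ω ∈ C <;> simp [h1, h2]
  -- The measures with densities `f` and `g` agree on the π-system of sets `B ∩ C`, because
  -- independence splits off the factor `P C`; finiteness lets the agreement extend.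
  have : IsFiniteMeasure (P.withDensity f) := isFiniteMeasure_withDensity hfin
  have key := ext_on_measurableSpace_of_generate_finite (μ := P.withDensity f)
    (ν := P.withDensity g) mΩ
    (Set.image2 (· ∩ ·) {s | MeasurableSet[m₁] s} {s | MeasurableSet[m₂] s}) ?_ hle
    (MeasurableSpace.generateFrom_image2_inter m₁ m₂) ?_ ?_ hA
  · rwa [withDensity_apply _ (hle A hA), withDensity_apply _ (hle A hA)] at key
  · rintro _ ⟨B, hB, C, hC, rfl⟩
    have hm : MeasurableSet (B ∩ C) := (hmf _ (hm₁ _ hB)).inter (hm₂ _ hC)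
    rw [withDensity_apply _ hm, withDensity_apply _ hm, hprod hf B C hB hC, hprod hg B C hB hC,
      hfg B hB]
  · rintro _ ⟨B, hB, C, hC, rfl⟩ _ ⟨B', hB', C', hC', rfl⟩ _
    exact ⟨B ∩ B', MeasurableSet.inter hB hB', C ∩ C', MeasurableSet.inter hC hC',
      Set.inter_inter_inter_comm B B' C C'⟩
  · rw [withDensity_apply _ .univ, withDensity_apply _ .univ]
    exact hfg _ MeasurableSet.univ

/-- Admitting the entire path of `I`, future included, costs nothing, since it is independent of
`X`. -/
theorem pairFiltration_le_sup {Ω : Type*} [MeasurableSpace Ω] (X I : ℝ≥0 → Ω → ℝ)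
    (hX : ∀ t, Measurable (X t)) (hI : ∀ t, Measurable (I t)) (s : ℝ≥0) :
    pairFiltration X I hX hI s
      ≤ (⨆ u ≤ s, MeasurableSpace.comap (X u) inferInstance)
        ⊔ MeasurableSpace.comap (fun ω t ↦ I t ω) inferInstance := by
  refine iSup₂_le fun u hu ↦ ?_
  rw [← measurable_iff_comap_le]
  refine Measurable.prodMk ?_ ?_
  · rw [measurable_iff_comap_le]
    exact le_trans (le_iSup₂ (f := fun u (_ : u ≤ s) ↦
      MeasurableSpace.comap (X u) inferInstance) u hu) le_sup_left
  · refine Measurable.mono ?_ le_sup_right le_rfl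
    have h := (measurable_pi_apply u).comp (comap_measurable (fun ω t ↦ I t ω))
    exact h

namespace IsJumpDiffusionNoise

variable {Ω : Type*} [MeasurableSpace Ω] {p : JumpDiffusionParams}
  {W : ℝ≥0 → Ω → ℝ} {N : ℝ≥0 → Ω → ℕ} {U : ℕ → Ω → ℝ} {P : Measure Ω} [IsProbabilityMeasure P]

theorem lintegral_rpow_jumpDiffusion (hn : IsJumpDiffusionNoise p W N U P) {x : ℝ} (hx : 0 < x)
    {θ : ℝ} (hInt : Integrable (fun ω ↦ (1 + U 0 ω) ^ θ) P) (t : ℝ≥0) :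
    ∫⁻ ω, ENNReal.ofReal (jumpDiffusion p x W N U t ω ^ θ) ∂P
      = ENNReal.ofReal (x ^ θ)
        * ENNReal.ofReal (Real.exp (p.momentRate θ (∫ ω, (1 + U 0 ω) ^ θ ∂P) * t)) := by
  have h := hn.setLIntegral_rpow_jumpDiffusion hx hInt (zero_le (a := t)) MeasurableSet.univ
  have h0 : ∫⁻ ω, ENNReal.ofReal (jumpDiffusion p x W N U 0 ω ^ θ) ∂P
      = ENNReal.ofReal (x ^ θ) := by
    have : ∀ᵐ ω ∂P, ENNReal.ofReal (jumpDiffusion p x W N U 0 ω ^ θ) = ENNReal.ofReal (x ^ θ) := by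
      filter_upwards [hn.brownian.eval_zero_ae_eq_zero, hn.poisson.zero] with ω hW hN
      simp [jumpDiffusion, hW, hN]
    rw [lintegral_congr_ae this]
    simp
  rw [setLIntegral_univ, setLIntegral_univ, h0] at h
  rw [h, NNReal.coe_zero, sub_zero]

/-- The moment of a jump-diffusion `X` at time `t` on an event known at time `s` to an observer
of `X` and of an independent process `I`. -/
theorem setLIntegral_rpow_pairFiltration (hn : IsJumpDiffusionNoise p W N U P) {x : ℝ}
    (hx : 0 < x) {θ : ℝ} (hInt : Integrable (fun ω ↦ (1 + U 0 ω) ^ θ) P) {X I : ℝ≥0 → Ω → ℝ}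
    (hX : X = jumpDiffusion p x W N U) (mX : ∀ t, Measurable (X t)) (mI : ∀ t, Measurable (I t))
    (hXI : IndepFun (fun ω t ↦ X t ω) (fun ω t ↦ I t ω) P) {s t : ℝ≥0} (hst : s ≤ t) {A : Set Ω}
    (hA : MeasurableSet[pairFiltration X I mX mI s] A) :
    ∫⁻ ω in A, ENNReal.ofReal (X t ω ^ θ) ∂P
      = ∫⁻ ω in A, ENNReal.ofReal (X s ω ^ θ) * ENNReal.ofReal
          (Real.exp (p.momentRate θ (∫ ω, (1 + U 0 ω) ^ θ ∂P) * (t - s))) ∂P := by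
  have mpath (u : ℝ≥0) : Measurable[MeasurableSpace.comap (fun ω t ↦ X t ω) inferInstance] (X u) :=
    by
      have h := (measurable_pi_apply u).comp (comap_measurable (fun ω t ↦ X t ω))
      exact h
  refine setLIntegral_eq_of_indep_sup
    (mf := MeasurableSpace.comap (fun ω t ↦ X t ω) inferInstance)
    (iSup₂_le fun u _ ↦ (mpath u).comap_le)
    (measurable_pi_lambda _ mX).comap_le (measurable_pi_lambda _ mI).comap_le hXI
    ((mpath t).pow_const θ).ennreal_ofReal (((mpath s).pow_const θ).ennreal_ofReal.mul_const _)
    ?_ (fun B hB ↦ ?_) (pairFiltration_le_sup X I mX mI s A hA)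
  · subst hX
    rw [hn.lintegral_rpow_jumpDiffusion hx hInt]
    exact ENNReal.mul_ne_top ENNReal.ofReal_ne_top ENNReal.ofReal_ne_top
  · subst hX
    rw [hn.setLIntegral_rpow_jumpDiffusion hx hInt hst hB, lintegral_mul_const _
      ((mX s).pow_const θ).ennreal_ofReal]

end IsJumpDiffusionNoise

/-! ### The discounted moment martingale. -/

/-- The process `max (X_t ^ θ) 0 * e ^ (-c t)`. -/
noncomputable def discountedMoment {Ω : Type*} (X : ℝ≥0 → Ω → ℝ) (θ c : ℝ) (t : ℝ≥0) (ω : Ω) : ℝ :=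
  max (X t ω ^ θ) 0 * Real.exp (-c * t)

/-- The maximum with `0` serves to have this at every `ω`, whereas `X` is positive only almost
surely. -/
theorem discountedMoment_nonneg {Ω : Type*} (X : ℝ≥0 → Ω → ℝ) (θ c : ℝ) (t : ℝ≥0) (ω : Ω) :
    0 ≤ discountedMoment X θ c t ω :=
  mul_nonneg (le_max_right _ _) (Real.exp_pos _).le

theorem ofReal_discountedMoment {Ω : Type*} (X : ℝ≥0 → Ω → ℝ) (θ c : ℝ) (t : ℝ≥0) (ω : Ω) :
    ENNReal.ofReal (discountedMoment X θ c t ω)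
      = ENNReal.ofReal (X t ω ^ θ) * ENNReal.ofReal (Real.exp (-c * t)) := by
  rw [discountedMoment, ENNReal.ofReal_mul (le_max_right _ _)]
  simp

/-- The discounted moment of a jump-diffusion is a martingale. -/
theorem IsJumpDiffusionNoise.martingale_discountedMoment {Ω : Type*} [MeasurableSpace Ω]
    {p : JumpDiffusionParams} {W : ℝ≥0 → Ω → ℝ} {N : ℝ≥0 → Ω → ℕ} {U : ℕ → Ω → ℝ}
    {P : Measure Ω} [IsProbabilityMeasure P] (hn : IsJumpDiffusionNoise p W N U P) {x : ℝ}
    (hx : 0 < x) {θ : ℝ} (hInt : Integrable (fun ω ↦ (1 + U 0 ω) ^ θ) P) {X I : ℝ≥0 → Ω → ℝ}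
    (hX : X = jumpDiffusion p x W N U) (mX : ∀ t, Measurable (X t)) (mI : ∀ t, Measurable (I t))
    (hXI : IndepFun (fun ω t ↦ X t ω) (fun ω t ↦ I t ω) P) :
    Martingale (discountedMoment X θ (p.momentRate θ (∫ ω, (1 + U 0 ω) ^ θ ∂P)))
      (pairFiltration X I mX mI) P := by
  set c := p.momentRate θ (∫ ω, (1 + U 0 ω) ^ θ ∂P) with hc
  have hadapt (t : ℝ≥0) :
      StronglyMeasurable[pairFiltration X I mX mI t] (discountedMoment X θ c t) := by
    have h1 : Measurable[pairFiltration X I mX mI t] (X t) :=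
      measurable_fst.comp (measurable_iff_comap_le.2 (le_iSup₂ (f := fun u (_ : u ≤ t) ↦
        MeasurableSpace.comap (fun ω ↦ (X u ω, I u ω)) inferInstance) t le_rfl))
    have h2 : Measurable[pairFiltration X I mX mI t] (discountedMoment X θ c t) :=
      ((h1.pow_const θ).max measurable_const).mul_const _
    exact h2.stronglyMeasurable
  have hmeas (t : ℝ≥0) : StronglyMeasurable (discountedMoment X θ c t) :=
    (hadapt t).mono ((pairFiltration X I mX mI).le t)
  have hintM (t : ℝ≥0) : Integrable (discountedMoment X θ c t) P := by
    refine ⟨(hmeas t).aestronglyMeasurable, ?_⟩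
    rw [hasFiniteIntegral_iff_ofReal
      (Filter.Eventually.of_forall fun ω ↦ discountedMoment_nonneg X θ c t ω)]
    simp_rw [ofReal_discountedMoment]
    rw [lintegral_mul_const _ ((mX t).pow_const θ).ennreal_ofReal, hX,
      hn.lintegral_rpow_jumpDiffusion hx hInt]
    exact (ENNReal.mul_ne_top (ENNReal.mul_ne_top ENNReal.ofReal_ne_top ENNReal.ofReal_ne_top)
      ENNReal.ofReal_ne_top).lt_top
  refine ⟨hadapt, fun s t hst ↦ ?_⟩
  refine (ae_eq_condExp_of_forall_setIntegral_eq ((pairFiltration X I mX mI).le s) (hintM t)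
    (fun _ _ _ ↦ (hintM s).integrableOn) (fun A hA _ ↦ ?_)
    (hadapt s).aestronglyMeasurable).symm
  rw [integral_eq_lintegral_of_nonneg_ae
      (Filter.Eventually.of_forall fun ω ↦ discountedMoment_nonneg X θ c s ω)
      (hmeas s).aestronglyMeasurable,
    integral_eq_lintegral_of_nonneg_ae
      (Filter.Eventually.of_forall fun ω ↦ discountedMoment_nonneg X θ c t ω)
      (hmeas t).aestronglyMeasurable]
  congr 1
  simp_rw [ofReal_discountedMoment]
  rw [lintegral_mul_const _ ((mX t).pow_const θ).ennreal_ofReal,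
    hn.setLIntegral_rpow_pairFiltration hx hInt hX mX mI hXI hst hA, ← hc,
    ← lintegral_mul_const _ (((mX s).pow_const θ).ennreal_ofReal.mul_const _)]
  refine lintegral_congr fun ω ↦ ?_
  rw [mul_assoc, ← ENNReal.ofReal_mul (Real.exp_pos _).le, ← Real.exp_add]
  congr 3
  ring

/-! ### Optional stopping in continuous time. -/

open Filter Topology

/-- The first point of the grid of mesh `1 / (k + 1)` that is strictly larger than `t`. -/
noncomputable def gridAbove (k : ℕ) (t : ℝ≥0) : ℝ≥0 := (⌊(k + 1) * t⌋₊ + 1) / (k + 1)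

theorem lt_gridAbove (k : ℕ) (t : ℝ≥0) : t < gridAbove k t := by
  rw [gridAbove, lt_div_iff₀ (by positivity), mul_comm]
  exact Nat.lt_floor_add_one _

theorem gridAbove_le (k : ℕ) (t : ℝ≥0) : gridAbove k t ≤ t + 1 / (k + 1) := by
  have h : (⌊(k + 1) * t⌋₊ : ℝ≥0) ≤ (k + 1) * t := Nat.floor_le zero_le
  have h1 : (t + 1 / (k + 1)) * (k + 1) = (k + 1) * t + 1 := by field_simp
  rw [gridAbove, div_le_iff₀ (by positivity), h1]
  gcongr

theorem tendsto_gridAbove (t : ℝ≥0) : Tendsto (fun k ↦ gridAbove k t) atTop (𝓝[≥] t) := by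
  refine tendsto_nhdsWithin_iff.2 ⟨?_, Eventually.of_forall fun k ↦ (lt_gridAbove k t).le⟩
  refine tendsto_of_tendsto_of_tendsto_of_le_of_le tendsto_const_nhds ?_
    (fun k ↦ (lt_gridAbove k t).le) (fun k ↦ gridAbove_le k t)
  have h : Tendsto (fun k : ℕ ↦ (1 : ℝ≥0) / ((k : ℝ≥0) + 1)) atTop (𝓝 0) :=
    tendsto_one_div_add_atTop_nhds_zero_nat
  simpa using h.const_add t

/-- The bound on the right is a grid point not exceeding `i`, so whether the rounded time has come
by `i` is known at time `i`. -/
theorem gridAbove_le_iff (k : ℕ) (t i : ℝ≥0) :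
    gridAbove k t ≤ i ↔ t < (⌊(k + 1) * i⌋₊ : ℝ≥0) / (k + 1) := by
  rw [gridAbove, div_le_iff₀ (by positivity), lt_div_iff₀ (by positivity), mul_comm i, mul_comm t,
    ← Nat.floor_lt zero_le, ← Nat.cast_add_one, ← Nat.le_floor_iff zero_le, Nat.succ_le_iff]

theorem countable_range_gridAbove (k : ℕ) : (Set.range (gridAbove k)).Countable := by
  refine (Set.countable_range fun l : ℕ ↦ ((l : ℝ≥0) + 1) / (k + 1)).mono ?_
  rintro _ ⟨t, rfl⟩
  exact ⟨⌊(k + 1) * t⌋₊, rfl⟩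

section OptionalStopping

theorem untopA_coe_nnreal (u : ℝ≥0) : (u : WithTop ℝ≥0).untopA = u := rfl

variable {Ω : Type*} [mΩ : MeasurableSpace Ω] {ℱ : Filtration ℝ≥0 mΩ} {τ : Ω → WithTop ℝ≥0}

/-- Rounding a stopping time up to the grid of mesh `1 / (k + 1)`, cut off at `t`, gives a stopping
time. -/
theorem isStoppingTime_min_gridAbove (hτ : IsStoppingTime ℱ τ) {t : ℝ≥0} (hτt : ∀ ω, τ ω ≤ t)
    (k : ℕ) :
    IsStoppingTime ℱ fun ω ↦ ((min (gridAbove k (τ ω).untopA) t : ℝ≥0) : WithTop ℝ≥0) := by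
  intro i
  by_cases hi : t ≤ i
  · convert MeasurableSet.univ
    ext ω
    simp only [Set.mem_ofPred_eq, Set.mem_univ, iff_true]
    exact WithTop.coe_le_coe.2 ((min_le_right _ _).trans hi)
  · have hset : {ω | ((min (gridAbove k (τ ω).untopA) t : ℝ≥0) : WithTop ℝ≥0) ≤ i}
        = {ω | τ ω < ((⌊(k + 1) * i⌋₊ : ℝ≥0) / (k + 1) : ℝ≥0)} := by
      ext ω
      have hne : τ ω ≠ ⊤ := ne_top_of_le_ne_top WithTop.coe_ne_top (hτt ω)
      obtain ⟨u, hu⟩ := WithTop.ne_top_iff_exists.1 hne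
      simp only [Set.mem_ofPred_eq, ← hu, WithTop.coe_le_coe, untopA_coe_nnreal, min_le_iff, hi,
        or_false, WithTop.coe_lt_coe]
      exact gridAbove_le_iff k u i
    rw [hset]
    refine ℱ.mono ?_ _ (hτ.measurableSet_lt _)
    rw [div_le_iff₀ (by positivity), mul_comm i]
    exact Nat.floor_le zero_le

/-- **Optional stopping** for martingales with almost surely right-continuous paths: at a stopping
time `τ ≤ t`, the martingale is integrable, and has the same integrals as at `t` on the
events prior to `τ`. -/
theorem MeasureTheory.Martingale.setIntegral_stoppedValue_eq {P : Measure Ω}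
    [IsProbabilityMeasure P] {M : ℝ≥0 → Ω → ℝ} (hM : Martingale M ℱ P)
    (hcont : ∀ᵐ ω ∂P, ∀ t, ContinuousWithinAt (fun s ↦ M s ω) (Set.Ici t) t)
    (hτ : IsStoppingTime ℱ τ) {t : ℝ≥0} (hτt : ∀ ω, τ ω ≤ t) {A : Set Ω}
    (hA : MeasurableSet[hτ.measurableSpace] A) :
    Integrable (stoppedValue M τ) P ∧ ∫ ω in A, stoppedValue M τ ω ∂P = ∫ ω in A, M t ω ∂P := by
  let σ : ℕ → Ω → WithTop ℝ≥0 := fun k ω ↦ ((min (gridAbove k (τ ω).untopA) t : ℝ≥0) : WithTop ℝ≥0)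
  have hσ (k : ℕ) : IsStoppingTime ℱ (σ k) := isStoppingTime_min_gridAbove hτ hτt k
  have hσt (k : ℕ) (ω : Ω) : σ k ω ≤ t := WithTop.coe_le_coe.2 (min_le_right _ _)
  have hτσ (k : ℕ) : τ ≤ σ k := by
    intro ω
    have hne : τ ω ≠ ⊤ := ne_top_of_le_ne_top WithTop.coe_ne_top (hτt ω)
    have ht := hτt ω
    simp only [σ]
    obtain ⟨u, hu⟩ := WithTop.ne_top_iff_exists.1 hne
    rw [← hu] at ht ⊢
    rw [untopA_coe_nnreal]
    exact WithTop.coe_le_coe.2 (le_min (lt_gridAbove k u).le (WithTop.coe_le_coe.1 ht))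
  have hcount (k : ℕ) : (Set.range (σ k)).Countable := by
    refine ((countable_range_gridAbove k).image
      (fun y ↦ ((min y t : ℝ≥0) : WithTop ℝ≥0))).mono ?_
    rintro _ ⟨ω, rfl⟩
    exact ⟨_, ⟨_, rfl⟩, rfl⟩
  have hcond (k : ℕ) : stoppedValue M (σ k) =ᵐ[P] P[M t | (hσ k).measurableSpace] :=
    hM.stoppedValue_ae_eq_condExp_of_le_const_of_countable_range (hσ k) (hσt k) (hcount k)
  -- The approximations are conditional expectations of the single variable `M t`, hence uniformly
  -- integrable; their almost sure limit, given by right-continuity, is then a limit in `L¹`.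
  have hui : UniformIntegrable (fun k ↦ stoppedValue M (σ k)) 1 P :=
    ((hM.integrable t).uniformIntegrable_condExp fun k ↦ (hσ k).measurableSpace_le).ae_eq
      fun k ↦ (hcond k).symm
  have hlim : ∀ᵐ ω ∂P, Tendsto (fun k ↦ stoppedValue M (σ k) ω) atTop (𝓝 (stoppedValue M τ ω)) := by
    filter_upwards [hcont] with ω hω
    have hne : τ ω ≠ ⊤ := ne_top_of_le_ne_top WithTop.coe_ne_top (hτt ω)
    have ht := hτt ω
    simp only [stoppedValue, σ, untopA_coe_nnreal]
    obtain ⟨u, hu⟩ := WithTop.ne_top_iff_exists.1 hne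
    rw [← hu] at ht ⊢
    rw [untopA_coe_nnreal]
    refine (hω u).tendsto.comp (tendsto_nhdsWithin_iff.2 ⟨?_, Eventually.of_forall fun k ↦
      le_min (lt_gridAbove k u).le (WithTop.coe_le_coe.1 ht)⟩)
    have h := ((tendsto_gridAbove u).mono_right nhdsWithin_le_nhds).min
      (tendsto_const_nhds (x := t))
    rwa [min_eq_left (WithTop.coe_le_coe.1 ht)] at h
  have hmem : MemLp (stoppedValue M τ) 1 P := hui.memLp_of_ae_tendsto hlim
  refine ⟨memLp_one_iff_integrable.1 hmem, ?_⟩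
  have hL1 := tendsto_Lp_finite_of_tendsto_ae le_rfl ENNReal.one_ne_top hui.1 hmem hui.2.1 hlim
  have hInt := tendsto_setIntegral_of_L1' _ hmem.1
    (Eventually.of_forall fun k ↦ memLp_one_iff_integrable.1 (hui.memLp k)) hL1 A
  refine tendsto_nhds_unique hInt ?_
  -- As `τ ≤ σ k`, an event prior to `τ` is prior to every `σ k`.
  have hconst (k : ℕ) : ∫ ω in A, stoppedValue M (σ k) ω ∂P = ∫ ω in A, M t ω ∂P := by
    rw [setIntegral_congr_ae ((hσ k).measurableSpace_le _
        (hτ.measurableSpace_mono (hσ k) (hτσ k) _ hA)) ((hcond k).mono fun ω h _ ↦ h)]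
    exact setIntegral_condExp _ (hM.integrable t)
      (hτ.measurableSpace_mono (hσ k) (hτσ k) _ hA)
  simp only [hconst]
  exact tendsto_const_nhds

end OptionalStopping

/-! ### Right-continuous paths and joint measurability. -/

/-- A process with almost surely right-continuous paths coincides almost surely, at all times
simultaneously, with a jointly measurable one. -/
theorem exists_measurable_uncurry_of_rightCont {Ω : Type*} [MeasurableSpace Ω] {P : Measure Ω}
    {Z : ℝ≥0 → Ω → ℝ} (hZ : ∀ t, Measurable (Z t))
    (hcont : ∀ᵐ ω ∂P, ∀ t, ContinuousWithinAt (fun s ↦ Z s ω) (Set.Ici t) t) :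
    ∃ Z' : ℝ≥0 × Ω → ℝ, Measurable Z' ∧ ∀ᵐ ω ∂P, ∀ t, Z t ω = Z' (t, ω) := by
  -- The set of bad paths need not be measurable; the new process is zero on a measurable null set
  -- containing it, and elsewhere the limit of its values at grid points.
  obtain ⟨S, hS, hSm, hPS⟩ := exists_measurable_superset_of_null (ae_iff.1 hcont)
  have hgood : ∀ ω ∈ Sᶜ, ∀ t, ContinuousWithinAt (fun s ↦ Z s ω) (Set.Ici t) t := fun ω hω ↦ by
    by_contra hbad
    exact hω (hS hbad)
  refine ⟨fun q ↦ Sᶜ.indicator (Z q.1) q.2, ?_, ?_⟩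
  · refine measurable_of_tendsto_metrizable
      (f := fun (k : ℕ) (q : ℝ≥0 × Ω) ↦ Sᶜ.indicator (Z (gridAbove k q.1)) q.2) (fun k ↦ ?_) ?_
    · have h1 : Measurable fun q : ℕ × Ω ↦ Sᶜ.indicator (Z (((q.1 : ℝ≥0) + 1) / (k + 1))) q.2 :=
        measurable_from_prod_countable_right fun l ↦
          show Measurable fun ω ↦ Sᶜ.indicator (Z (((l : ℝ≥0) + 1) / (k + 1))) ω from
          (hZ _).indicator hSm.compl
      have h2 : Measurable fun q : ℝ≥0 × Ω ↦ (⌊(k + 1) * q.1⌋₊, q.2) := by fun_prop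
      have h3 := h1.comp h2
      exact h3
    · rw [tendsto_pi_nhds]
      rintro ⟨t, ω⟩
      by_cases hω : ω ∈ Sᶜ
      · simp only [Set.indicator_of_mem hω]
        exact (hgood ω hω t).tendsto.comp (tendsto_gridAbove t)
      · simp only [Set.indicator_of_notMem hω]
        exact tendsto_const_nhds
  · have : ∀ᵐ ω ∂P, ω ∈ Sᶜ := by
      rw [ae_iff]
      simpa using hPS
    filter_upwards [this] with ω hω t
    simp only [Set.indicator_of_mem hω]

/-- A right-continuous integer-valued path is constant just after `t`, so the product of jump
factors is locally frozen there. -/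
theorem IsJumpDiffusionNoise.rightCont_jumpDiffusion {Ω : Type*} [MeasurableSpace Ω]
    {p : JumpDiffusionParams} {W : ℝ≥0 → Ω → ℝ} {N : ℝ≥0 → Ω → ℕ} {U : ℕ → Ω → ℝ}
    {P : Measure Ω} (hn : IsJumpDiffusionNoise p W N U P) (x : ℝ) :
    ∀ᵐ ω ∂P, ∀ t, ContinuousWithinAt (fun s ↦ jumpDiffusion p x W N U s ω) (Set.Ici t) t := by
  filter_upwards [hn.brownian.cont, hn.poisson.right_cont] with ω hW hN t
  have hNt : ∀ᶠ s in 𝓝[Set.Ici t] t, N s ω = N t ω := by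
    have := (hN t).tendsto
    rw [nhds_discrete] at this
    exact tendsto_pure.1 this
  have hc : Continuous fun s : ℝ≥0 ↦
      x * Real.exp ((p.μ - p.σ ^ 2 / 2 - p.lam * p.m) * s + p.σ * W s ω)
        * ∏ k ∈ Finset.range (N t ω), (1 + U k ω) := by fun_prop
  refine hc.continuousWithinAt.congr_of_eventuallyEq ?_ rfl
  filter_upwards [hNt] with s hs
  rw [jumpDiffusion, hs]

theorem rightCont_discountedMoment {Ω : Type*} {X : ℝ≥0 → Ω → ℝ} {θ : ℝ} (hθ : 0 ≤ θ) (c : ℝ)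
    {ω : Ω} {t : ℝ≥0} (h : ContinuousWithinAt (fun s ↦ X s ω) (Set.Ici t) t) :
    ContinuousWithinAt (fun s ↦ discountedMoment X θ c s ω) (Set.Ici t) t := by
  unfold discountedMoment
  refine ContinuousWithinAt.mul ((h.rpow_const (Or.inr hθ)).max continuousWithinAt_const) ?_
  exact Continuous.continuousWithinAt (by fun_prop)

/-! ### Integrals over the times after a stopping time. -/

section StoppedIntegral

variable {Ω : Type*} [mΩ : MeasurableSpace Ω] {ℱ : Filtration ℝ≥0 mΩ} {τ : Ω → WithTop ℝ≥0}
  {P : Measure Ω}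

theorem MeasureTheory.IsStoppingTime.measurableSet_lt_top (hτ : IsStoppingTime ℱ τ) :
    MeasurableSet {ω | τ ω < ⊤} := by
  have h : {ω | τ ω < ⊤} = {ω | τ ω = ⊤}ᶜ := by ext ω; simp [lt_top_iff_ne_top]
  rw [h]
  exact hτ.measurableSet_eq_top.compl

theorem MeasureTheory.IsStoppingTime.measurable_untopA (hτ : IsStoppingTime ℱ τ) :
    Measurable fun ω ↦ (τ ω).untopA := by
  refine measurable_of_Iic fun a ↦ ?_
  -- At `⊤`, `untopA` is a fixed default value, so the event `τ = ⊤` lies wholly inside or wholly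
  -- outside the preimage.
  have h : (fun ω ↦ (τ ω).untopA) ⁻¹' Set.Iic a
      = {ω | τ ω ≤ a} ∪ ({ω | τ ω = ⊤} ∩ {_ω | (⊤ : WithTop ℝ≥0).untopA ≤ a}) := by
    ext ω
    by_cases hω : τ ω = ⊤
    · have h1 : ¬ (⊤ : WithTop ℝ≥0) ≤ a := not_le.2 (WithTop.coe_lt_top a)
      simp only [Set.mem_preimage, Set.mem_Iic, Set.mem_union, Set.mem_inter_iff,
        Set.mem_ofPred_eq, hω, h1, true_and, false_or]
    · obtain ⟨u, hu⟩ := WithTop.ne_top_iff_exists.1 hω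
      have hu' : (τ ω).untopA = u := by rw [← hu, untopA_coe_nnreal]
      simp only [Set.mem_preimage, Set.mem_Iic, Set.mem_union, Set.mem_inter_iff,
        Set.mem_ofPred_eq, hω, false_and, or_false, hu']
      rw [← hu]
      exact (WithTop.coe_le_coe (a := a) (b := u)).symm
  rw [h]
  exact (ℱ.le _ _ (hτ.measurableSet_le a)).union (hτ.measurableSet_eq_top.inter (.const _))

/-- This matches the two orders of integration: a range of `t` for fixed `ω`, an event prior to time
`t - n` for fixed `t`. When `t ≤ n` both sides are false. -/
theorem lt_toNNReal_sub_iff (v : WithTop ℝ≥0) (n t : ℝ) :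
    v < ((t - n).toNNReal : WithTop ℝ≥0) ↔ v < ⊤ ∧ (v.untopA : ℝ) + n < t := by
  by_cases hv : v = ⊤
  · subst hv
    exact ⟨fun h ↦ absurd h not_top_lt, fun h ↦ absurd h.1 (lt_irrefl _)⟩
  · obtain ⟨u, rfl⟩ := WithTop.ne_top_iff_exists.1 hv
    rw [WithTop.coe_lt_coe, Real.lt_toNNReal_iff_coe_lt, untopA_coe_nnreal, lt_sub_iff_add_lt]
    exact ⟨fun h ↦ ⟨WithTop.coe_lt_top u, h⟩, fun h ↦ h.2⟩

/-- Fubini's theorem for the integral over the times after `τ + n`. -/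
theorem MeasureTheory.IsStoppingTime.setLIntegral_Ioi [SFinite P] (hτ : IsStoppingTime ℱ τ) (n : ℝ)
    {φ : Ω → ℝ → ℝ≥0∞} (hφ : Measurable (Function.uncurry φ)) :
    ∫⁻ ω in {ω | τ ω < ⊤}, (∫⁻ t in Set.Ioi (((τ ω).untopA : ℝ) + n), φ ω t) ∂P
      = ∫⁻ t, ∫⁻ ω in {ω | τ ω < ((t - n).toNNReal : WithTop ℝ≥0)}, φ ω t ∂P := by
  let S : Set (Ω × ℝ) := {q | τ q.1 < ⊤ ∧ ((τ q.1).untopA : ℝ) + n < q.2}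
  have hT : Measurable fun ω ↦ ((τ ω).untopA : ℝ) := hτ.measurable_untopA.coe_nnreal_real
  have hS : MeasurableSet S := by
    refine MeasurableSet.inter (measurable_fst hτ.measurableSet_lt_top) ?_
    exact _root_.measurableSet_lt ((hT.comp measurable_fst).add_const n) measurable_snd
  have hm : Measurable (S.indicator (Function.uncurry φ)) := hφ.indicator hS
  calc ∫⁻ ω in {ω | τ ω < ⊤}, (∫⁻ t in Set.Ioi (((τ ω).untopA : ℝ) + n), φ ω t) ∂P
      = ∫⁻ ω, (∫⁻ t, S.indicator (Function.uncurry φ) (ω, t)) ∂P := by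
        rw [← lintegral_indicator hτ.measurableSet_lt_top]
        refine lintegral_congr fun ω ↦ ?_
        by_cases hω : τ ω < ⊤
        · rw [Set.indicator_of_mem (by exact hω), ← lintegral_indicator measurableSet_Ioi]
          refine lintegral_congr fun t ↦ ?_
          by_cases ht : ((τ ω).untopA : ℝ) + n < t
          · rw [Set.indicator_of_mem (by exact ht), Set.indicator_of_mem (by exact ⟨hω, ht⟩)]
            rfl
          · rw [Set.indicator_of_notMem (by exact ht), Set.indicator_of_notMem fun h ↦ ht h.2]
        · rw [Set.indicator_of_notMem (by exact hω)]
          have (t : ℝ) : S.indicator (Function.uncurry φ) (ω, t) = 0 :=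
            Set.indicator_of_notMem (fun h ↦ hω h.1) _
          simp [this]
    _ = ∫⁻ t, ∫⁻ ω, S.indicator (Function.uncurry φ) (ω, t) ∂P :=
        lintegral_lintegral_swap hm.aemeasurable
    _ = _ := by
        refine lintegral_congr fun t ↦ ?_
        have hset : MeasurableSet {ω | τ ω < ((t - n).toNNReal : WithTop ℝ≥0)} :=
          ℱ.le _ _ (hτ.measurableSet_lt _)
        rw [← lintegral_indicator hset]
        refine lintegral_congr fun ω ↦ ?_
        by_cases hω : τ ω < ((t - n).toNNReal : WithTop ℝ≥0)
        · have hS' : (ω, t) ∈ S := (lt_toNNReal_sub_iff _ _ _).1 hω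
          rw [Set.indicator_of_mem hS', Set.indicator_of_mem (by exact hω)]
          rfl
        · have hS' : (ω, t) ∉ S := fun h ↦ hω ((lt_toNNReal_sub_iff _ _ _).2 h)
          rw [Set.indicator_of_notMem hS', Set.indicator_of_notMem (by exact hω)]

/-- Optional stopping applies to the bounded time `min τ r`, which equals `τ` on `{τ < r}`; that
event is prior to `min τ r`. -/
theorem MeasureTheory.Martingale.setLIntegral_stoppedValue_lt [IsProbabilityMeasure P]
    {M : ℝ≥0 → Ω → ℝ} (hM : Martingale M ℱ P) (hM0 : ∀ t ω, 0 ≤ M t ω)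
    (hcont : ∀ᵐ ω ∂P, ∀ t, ContinuousWithinAt (fun s ↦ M s ω) (Set.Ici t) t)
    (hτ : IsStoppingTime ℱ τ) {r t : ℝ≥0} (hrt : r ≤ t) :
    ∫⁻ ω in {ω | τ ω < r}, ENNReal.ofReal (M t ω) ∂P
      = ∫⁻ ω in {ω | τ ω < r}, ENNReal.ofReal (stoppedValue M τ ω) ∂P := by
  have hσ := hτ.min_const r
  have hσt : ∀ ω, min (τ ω) r ≤ (t : WithTop ℝ≥0) := fun ω ↦
    (min_le_right _ _).trans (WithTop.coe_le_coe.2 hrt)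
  have hA : MeasurableSet[hσ.measurableSpace] {ω | τ ω < r} := by
    have := hσ.measurableSet_lt' r
    convert this using 1
    ext ω
    refine ⟨fun h ↦ (min_le_left (τ ω) r).trans_lt (show τ ω < r from h), fun h ↦ ?_⟩
    exact (min_lt_iff.1 (show min (τ ω) r < r from h)).resolve_right (lt_irrefl _)
  have hAm : MeasurableSet {ω | τ ω < r} := ℱ.le _ _ (hτ.measurableSet_lt _)
  obtain ⟨hi, heq⟩ := hM.setIntegral_stoppedValue_eq hcont hσ hσt hA
  have h1 : ∫⁻ ω in {ω | τ ω < r}, ENNReal.ofReal (stoppedValue M τ ω) ∂P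
      = ∫⁻ ω in {ω | τ ω < r}, ENNReal.ofReal (stoppedValue M (fun ω ↦ min (τ ω) r) ω) ∂P := by
    refine setLIntegral_congr_fun hAm fun ω hω ↦ ?_
    have hω' : τ ω < r := hω
    simp only [stoppedValue, min_eq_left hω'.le]
  rw [h1, ← ofReal_integral_eq_lintegral_ofReal (hM.integrable t).integrableOn
      (Eventually.of_forall fun ω ↦ hM0 t ω),
    ← ofReal_integral_eq_lintegral_ofReal hi.integrableOn
      (Eventually.of_forall fun ω ↦ hM0 _ ω), heq]

theorem lintegral_Ioi_exp_neg_mul {h : ℝ} (hh : 0 < h) (a : ℝ) :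
    ∫⁻ t in Set.Ioi a, ENNReal.ofReal (Real.exp (-h * t))
      = ENNReal.ofReal (Real.exp (-h * a) / h) := by
  rw [← ofReal_integral_eq_lintegral_ofReal (integrableOn_exp_mul_Ioi (by linarith) a)
    (Eventually.of_forall fun t ↦ (Real.exp_pos _).le), integral_exp_mul_Ioi (by linarith)]
  congr 1
  rw [div_neg, neg_div, neg_neg]

/-- The expected integral of a nonnegative martingale, discounted at rate `h`, over the times
after `τ + n`. -/
theorem MeasureTheory.Martingale.setLIntegral_Ioi_stopping [IsProbabilityMeasure P]
    {M : ℝ≥0 → Ω → ℝ} (hM : Martingale M ℱ P) (hM0 : ∀ t ω, 0 ≤ M t ω)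
    (hcont : ∀ᵐ ω ∂P, ∀ t, ContinuousWithinAt (fun s ↦ M s ω) (Set.Ici t) t)
    (hτ : IsStoppingTime ℱ τ) {h n : ℝ} (hh : 0 < h) (hn : 0 ≤ n) :
    ∫⁻ ω in {ω | τ ω < ⊤}, (∫⁻ t in Set.Ioi (((τ ω).untopA : ℝ) + n),
        ENNReal.ofReal (M t.toNNReal ω * Real.exp (-h * t))) ∂P
      = ∫⁻ ω in {ω | τ ω < ⊤}, ENNReal.ofReal
          (stoppedValue M τ ω * Real.exp (-h * (τ ω).untopA) * (Real.exp (-h * n) / h)) ∂P := by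
  have hMm (t : ℝ≥0) : Measurable (M t) := ((hM.1 t).mono (ℱ.le t)).measurable
  obtain ⟨M', hM'm, hMM'⟩ := exists_measurable_uncurry_of_rightCont hMm hcont
  have hT := hτ.measurable_untopA
  have hMT : Measurable fun ω ↦ M' ((τ ω).untopA, ω) := hM'm.comp (hT.prodMk measurable_id)
  calc ∫⁻ ω in {ω | τ ω < ⊤}, (∫⁻ t in Set.Ioi (((τ ω).untopA : ℝ) + n),
        ENNReal.ofReal (M t.toNNReal ω * Real.exp (-h * t))) ∂P
      = ∫⁻ ω in {ω | τ ω < ⊤}, (∫⁻ t in Set.Ioi (((τ ω).untopA : ℝ) + n),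
        ENNReal.ofReal (M' (t.toNNReal, ω) * Real.exp (-h * t))) ∂P := by
        refine lintegral_congr_ae (ae_restrict_of_ae ?_)
        filter_upwards [hMM'] with ω hω
        simp only [hω]
    _ = ∫⁻ t : ℝ, ∫⁻ ω in {ω | τ ω < ((t - n).toNNReal : WithTop ℝ≥0)},
          ENNReal.ofReal (M' (t.toNNReal, ω) * Real.exp (-h * t)) ∂P := by
        refine hτ.setLIntegral_Ioi n ?_
        have h1 : Measurable fun q : Ω × ℝ ↦ M' (q.2.toNNReal, q.1) :=
          hM'm.comp (by fun_prop)
        exact (h1.mul (by fun_prop)).ennreal_ofReal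
    _ = ∫⁻ t : ℝ, ∫⁻ ω in {ω | τ ω < ((t - n).toNNReal : WithTop ℝ≥0)},
          ENNReal.ofReal (M' ((τ ω).untopA, ω)) * ENNReal.ofReal (Real.exp (-h * t)) ∂P := by
        refine lintegral_congr fun t ↦ ?_
        have e1 : ∫⁻ ω in {ω | τ ω < ((t - n).toNNReal : WithTop ℝ≥0)},
            ENNReal.ofReal (M' (t.toNNReal, ω) * Real.exp (-h * t)) ∂P
            = ∫⁻ ω in {ω | τ ω < ((t - n).toNNReal : WithTop ℝ≥0)},
              ENNReal.ofReal (M t.toNNReal ω) * ENNReal.ofReal (Real.exp (-h * t)) ∂P := by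
          refine lintegral_congr_ae (ae_restrict_of_ae ?_)
          filter_upwards [hMM'] with ω hω
          rw [← hω, ENNReal.ofReal_mul (hM0 _ _)]
        have e2 : ∫⁻ ω in {ω | τ ω < ((t - n).toNNReal : WithTop ℝ≥0)},
            ENNReal.ofReal (M' ((τ ω).untopA, ω)) ∂P
            = ∫⁻ ω in {ω | τ ω < ((t - n).toNNReal : WithTop ℝ≥0)},
              ENNReal.ofReal (stoppedValue M τ ω) ∂P := by
          refine lintegral_congr_ae (ae_restrict_of_ae ?_)
          filter_upwards [hMM'] with ω hω
          rw [← hω, stoppedValue]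
        -- For fixed `t` the martingale at `t` gives way to its value at `τ`; `0 ≤ n` ensures that
        -- `t - n` does not exceed `t`.
        rw [e1, lintegral_mul_const _ (hMm _).ennreal_ofReal,
          lintegral_mul_const _ hMT.ennreal_ofReal, e2,
          hM.setLIntegral_stoppedValue_lt hM0 hcont hτ (Real.toNNReal_le_toNNReal (by linarith))]
    _ = ∫⁻ ω in {ω | τ ω < ⊤}, (∫⁻ t in Set.Ioi (((τ ω).untopA : ℝ) + n),
          ENNReal.ofReal (M' ((τ ω).untopA, ω)) * ENNReal.ofReal (Real.exp (-h * t))) ∂P := by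
        refine (hτ.setLIntegral_Ioi n (φ := fun ω t ↦
          ENNReal.ofReal (M' ((τ ω).untopA, ω)) * ENNReal.ofReal (Real.exp (-h * t))) ?_).symm
        exact (hMT.ennreal_ofReal.comp measurable_fst).mul (by fun_prop)
    _ = _ := by
        refine lintegral_congr_ae (ae_restrict_of_ae ?_)
        filter_upwards [hMM'] with ω hω
        rw [lintegral_const_mul _ (by fun_prop), lintegral_Ioi_exp_neg_mul hh, ← hω,
          ← ENNReal.ofReal_mul (hM0 _ _), stoppedValue, mul_assoc, mul_add, Real.exp_add,
          mul_div_assoc]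

end StoppedIntegral

/-! ### Extended expectations, measurability and finiteness of the payoffs. -/

/-- The extended expectation of a difference of nonnegative variables, the first one of finite
expectation. -/
theorem extExpectation_of_ae_eq_sub {Ω : Type*} [MeasurableSpace Ω] {P : Measure Ω}
    {Z a c : Ω → ℝ} (hZ : Z =ᵐ[P] fun ω ↦ a ω - c ω) (ha : ∀ᵐ ω ∂P, 0 ≤ a ω)
    (hc : ∀ᵐ ω ∂P, 0 ≤ c ω) (ham : AEMeasurable a P) (hcm : AEMeasurable c P)
    (hfin : ∫⁻ ω, ENNReal.ofReal (a ω) ∂P < ∞) :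
    AEMeasurable Z P ∧ ∫⁻ ω, ENNReal.ofReal (Z ω) ∂P < ∞ ∧
      extExpectation P Z = ((∫⁻ ω, ENNReal.ofReal (a ω) ∂P : ℝ≥0∞) : EReal)
        - ((∫⁻ ω, ENNReal.ofReal (c ω) ∂P : ℝ≥0∞) : EReal) := by
  have hZm : AEMeasurable Z P := (ham.sub hcm).congr hZ.symm
  have hZfin : ∫⁻ ω, ENNReal.ofReal (Z ω) ∂P < ∞ := by
    refine lt_of_le_of_lt (lintegral_mono_ae ?_) hfin
    filter_upwards [hZ, hc] with ω h1 h2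
    exact ENNReal.ofReal_le_ofReal (by rw [h1]; linarith)
  refine ⟨hZm, hZfin, ?_⟩
  -- The relation `Z⁺ - Z⁻ = a - c` is integrated as `Z⁺ + c = a + Z⁻`, which avoids subtracting
  -- infinities.
  have hsum : ∫⁻ ω, ENNReal.ofReal (Z ω) ∂P + ∫⁻ ω, ENNReal.ofReal (c ω) ∂P
      = ∫⁻ ω, ENNReal.ofReal (a ω) ∂P + ∫⁻ ω, ENNReal.ofReal (-Z ω) ∂P := by
    rw [← lintegral_add_left' hZm.ennreal_ofReal, ← lintegral_add_left' ham.ennreal_ofReal]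
    refine lintegral_congr_ae ?_
    filter_upwards [hZ, ha, hc] with ω h1 h2 h3
    rcases le_total 0 (Z ω) with h | h
    · rw [← ENNReal.ofReal_add h h3, ENNReal.ofReal_of_nonpos (by linarith : -Z ω ≤ 0), add_zero]
      congr 1
      rw [h1]
      ring
    · rw [← ENNReal.ofReal_add h2 (by linarith), ENNReal.ofReal_of_nonpos h, zero_add]
      congr 1
      rw [h1]
      ring
  unfold extExpectation
  generalize (∫⁻ ω, ENNReal.ofReal (Z ω) ∂P) = z at *
  generalize (∫⁻ ω, ENNReal.ofReal (-Z ω) ∂P) = z' at *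
  generalize (∫⁻ ω, ENNReal.ofReal (a ω) ∂P) = y at *
  generalize (∫⁻ ω, ENNReal.ofReal (c ω) ∂P) = y' at *
  lift z to ℝ≥0 using hZfin.ne
  lift y to ℝ≥0 using hfin.ne
  by_cases hz' : z' = ∞
  · have hy' : y' = ∞ := by
      rw [hz', add_top] at hsum
      exact (ENNReal.add_eq_top.1 hsum).resolve_left ENNReal.coe_ne_top
    simp [hz', hy', sub_eq_add_neg]
  · have hy' : y' ≠ ∞ := by
      intro h
      rw [h, add_top] at hsum
      exact hz' ((ENNReal.add_eq_top.1 hsum.symm).resolve_left ENNReal.coe_ne_top)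
    lift z' to ℝ≥0 using hz'
    lift y' to ℝ≥0 using hy'
    have h : (z : ℝ) + y' = y + z' := by exact_mod_cast hsum
    change ((z : ℝ) : EReal) - ((z' : ℝ) : EReal) = ((y : ℝ) : EReal) - ((y' : ℝ) : EReal)
    rw [← EReal.coe_sub, ← EReal.coe_sub]
    congr 1
    linarith

theorem aemeasurable_stoppedValue_of_rightCont {Ω : Type*} [mΩ : MeasurableSpace Ω]
    {P : Measure Ω} {ℱ : Filtration ℝ≥0 mΩ} {τ : Ω → WithTop ℝ≥0} (hτ : IsStoppingTime ℱ τ)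
    {Z : ℝ≥0 → Ω → ℝ} (hZ : ∀ t, Measurable (Z t))
    (hcont : ∀ᵐ ω ∂P, ∀ t, ContinuousWithinAt (fun s ↦ Z s ω) (Set.Ici t) t) :
    AEMeasurable (stoppedValue Z τ) P := by
  obtain ⟨Z', hZ', hZZ'⟩ := exists_measurable_uncurry_of_rightCont hZ hcont
  refine ⟨fun ω ↦ Z' ((τ ω).untopA, ω), hZ'.comp (hτ.measurable_untopA.prodMk measurable_id), ?_⟩
  filter_upwards [hZZ'] with ω hω
  exact hω _

theorem ae_measurable_path_of_rightCont {Ω : Type*} [MeasurableSpace Ω] {P : Measure Ω}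
    {Z : ℝ≥0 → Ω → ℝ} (hZ : ∀ t, Measurable (Z t))
    (hcont : ∀ᵐ ω ∂P, ∀ t, ContinuousWithinAt (fun s ↦ Z s ω) (Set.Ici t) t) :
    ∀ᵐ ω ∂P, Measurable fun t ↦ Z t ω := by
  obtain ⟨Z', hZ', hZZ'⟩ := exists_measurable_uncurry_of_rightCont hZ hcont
  filter_upwards [hZZ'] with ω hω
  simp only [hω]
  exact hZ'.comp measurable_prodMk_right

theorem aemeasurable_lintegral_Ioi_of_rightCont {Ω : Type*} [MeasurableSpace Ω] {P : Measure Ω}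
    {Z : ℝ≥0 → Ω → ℝ} (hZ : ∀ t, Measurable (Z t))
    (hcont : ∀ᵐ ω ∂P, ∀ t, ContinuousWithinAt (fun s ↦ Z s ω) (Set.Ici t) t) {T : Ω → ℝ}
    (hT : Measurable T) (h : ℝ) :
    AEMeasurable (fun ω ↦ ∫⁻ t in Set.Ioi (T ω),
      ENNReal.ofReal (Z t.toNNReal ω * Real.exp (-h * t))) P := by
  obtain ⟨Z', hZ', hZZ'⟩ := exists_measurable_uncurry_of_rightCont hZ hcont
  have hS : MeasurableSet {q : Ω × ℝ | T q.1 < q.2} :=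
    measurableSet_lt (hT.comp measurable_fst) measurable_snd
  have hm : Measurable fun q : Ω × ℝ ↦
      ENNReal.ofReal (Z' (q.2.toNNReal, q.1) * Real.exp (-h * q.2)) := by
    have h1 : Measurable fun q : Ω × ℝ ↦ Z' (q.2.toNNReal, q.1) := hZ'.comp (by fun_prop)
    exact (h1.mul (by fun_prop)).ennreal_ofReal
  refine ⟨_, (hm.indicator hS).lintegral_prod_right' (ν := volume), ?_⟩
  filter_upwards [hZZ'] with ω hω
  rw [← lintegral_indicator measurableSet_Ioi]
  refine lintegral_congr fun t ↦ ?_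
  by_cases ht : T ω < t
  · rw [Set.indicator_of_mem (by exact ht), Set.indicator_of_mem (by exact ht), hω]
  · rw [Set.indicator_of_notMem (by exact ht), Set.indicator_of_notMem (by exact ht)]

theorem IsJumpDiffusionNoise.jumpDiffusion_pos {Ω : Type*} [MeasurableSpace Ω]
    {p : JumpDiffusionParams} {W : ℝ≥0 → Ω → ℝ} {N : ℝ≥0 → Ω → ℕ} {U : ℕ → Ω → ℝ}
    {P : Measure Ω} (hn : IsJumpDiffusionNoise p W N U P) {x : ℝ} (hx : 0 < x) :
    ∀ᵐ ω ∂P, ∀ t, 0 < jumpDiffusion p x W N U t ω := by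
  filter_upwards [ae_all_iff.2 hn.neg_one_lt_U] with ω hU t
  exact mul_pos (mul_pos hx (Real.exp_pos _))
    (Finset.prod_pos fun k _ ↦ by linarith [hU k])

/-- The expected integral of a discounted nonnegative martingale over the times after `τ + n` is
finite. -/
theorem MeasureTheory.Martingale.lintegral_Ioi_lt_top {Ω : Type*} [mΩ : MeasurableSpace Ω]
    {P : Measure Ω} [IsProbabilityMeasure P] {ℱ : Filtration ℝ≥0 mΩ}
    {M : ℝ≥0 → Ω → ℝ} (hM : Martingale M ℱ P) (hM0 : ∀ t ω, 0 ≤ M t ω)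
    (hcont : ∀ᵐ ω ∂P, ∀ t, ContinuousWithinAt (fun s ↦ M s ω) (Set.Ici t) t)
    {T : Ω → ℝ} (hT : ∀ ω, 0 ≤ T ω) {h : ℝ} (hh : 0 < h) :
    ∫⁻ ω, (∫⁻ t in Set.Ioi (T ω), ENNReal.ofReal (M t.toNNReal ω * Real.exp (-h * t))) ∂P < ∞ := by
  -- Since `T ≥ 0`, the integral from time `0` is an upper bound, and it is the case of the stopping
  -- time `0` without delay.
  have key := hM.setLIntegral_Ioi_stopping hM0 hcont (isStoppingTime_const ℱ 0) hh le_rfl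
  have huniv : {ω : Ω | ((0 : ℝ≥0) : WithTop ℝ≥0) < ⊤} = Set.univ := by
    ext ω
    simp only [Set.mem_ofPred_eq, Set.mem_univ, iff_true]
    exact WithTop.coe_lt_top 0
  rw [huniv, setLIntegral_univ, setLIntegral_univ] at key
  calc ∫⁻ ω, (∫⁻ t in Set.Ioi (T ω), ENNReal.ofReal (M t.toNNReal ω * Real.exp (-h * t))) ∂P
      ≤ _ := by
        refine lintegral_mono fun ω ↦ lintegral_mono_set (Set.Ioi_subset_Ioi ?_)
        simpa [untopA_coe_nnreal] using hT ω
    _ = _ := key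
    _ < ∞ := by
        refine Integrable.lintegral_lt_top ?_
        exact (((hM.integrable 0).mul_const _).mul_const _)

/-- The discount splits into `e^{-(ρ-h)t}`, which compensates the growth of `X ^ θ`, and `e^{-ht}`,
which makes the time integral converge. -/
theorem profitDiff_mul_exp_eq {Ω : Type*} {X : ℝ≥0 → Ω → ℝ} {ω : Ω} (hX : ∀ t, 0 < X t ω)
    (κ₀ κ₁ θ ρ h : ℝ) {t : ℝ} (ht : 0 ≤ t) :
    profitDiff κ₀ κ₁ θ (X t.toNNReal ω) * Real.exp (-ρ * t)
      = (κ₁ - κ₀) * (discountedMoment X θ (ρ - h) t.toNNReal ω * Real.exp (-h * t)) := by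
  have hexp : Real.exp (-ρ * t) = Real.exp (-(ρ - h) * t) * Real.exp (-h * t) := by
    rw [← Real.exp_add]
    congr 1
    ring
  rw [profitDiff, discountedMoment, max_eq_left (Real.rpow_nonneg (hX _).le θ),
    Real.coe_toNNReal t ht, hexp]
  ring

theorem exp_mul_gainFun_eq {Ω : Type*} {X I : ℝ≥0 → Ω → ℝ} {ω : Ω} (hX : ∀ t, 0 < X t ω)
    (κ₀ κ₁ θ ρ h A : ℝ) (t : ℝ≥0) :
    Real.exp (-ρ * t) * gainFun κ₀ κ₁ θ A (X t ω) (I t ω)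
      = (κ₁ - κ₀) * (discountedMoment X θ (ρ - h) t ω * Real.exp (-h * t) * A)
        - I t ω * Real.exp (-ρ * t) := by
  have hexp : Real.exp (-ρ * t) = Real.exp (-(ρ - h) * t) * Real.exp (-h * t) := by
    rw [← Real.exp_add]
    congr 1
    ring
  rw [gainFun, discountedMoment, max_eq_left (Real.rpow_nonneg (hX _).le θ), hexp]
  ring

/-- If the inner integral of the discounted moment is finite, the discounted profit is integrable
after time `a` and its integral is the multiple `κ₁ - κ₀` of that of the discounted moment. -/
theorem integrableOn_and_integral_profitDiff {Ω : Type*} {X : ℝ≥0 → Ω → ℝ} {ω : Ω}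
    (hX : ∀ t, 0 < X t ω) (hXm : Measurable fun t ↦ X t ω) (κ₀ κ₁ θ ρ h : ℝ) {a : ℝ} (ha : 0 ≤ a)
    (hfin : ∫⁻ t in Set.Ioi a, ENNReal.ofReal
      (discountedMoment X θ (ρ - h) t.toNNReal ω * Real.exp (-h * t)) < ∞) :
    IntegrableOn (fun t : ℝ ↦ profitDiff κ₀ κ₁ θ (X t.toNNReal ω) * Real.exp (-ρ * t))
        (Set.Ioi a) ∧
      ∫ t in Set.Ioi a, profitDiff κ₀ κ₁ θ (X t.toNNReal ω) * Real.exp (-ρ * t)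
        = (κ₁ - κ₀) * (∫⁻ t in Set.Ioi a, ENNReal.ofReal
          (discountedMoment X θ (ρ - h) t.toNNReal ω * Real.exp (-h * t))).toReal := by
  have hnn (t : ℝ) : 0 ≤ discountedMoment X θ (ρ - h) t.toNNReal ω * Real.exp (-h * t) :=
    mul_nonneg (discountedMoment_nonneg _ _ _ _ _) (Real.exp_pos _).le
  have hm : Measurable fun t : ℝ ↦
      discountedMoment X θ (ρ - h) t.toNNReal ω * Real.exp (-h * t) := by
    unfold discountedMoment
    have h1 : Measurable fun t : ℝ ↦ X t.toNNReal ω := hXm.comp measurable_real_toNNReal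
    fun_prop
  have hInt : IntegrableOn (fun t : ℝ ↦
      discountedMoment X θ (ρ - h) t.toNNReal ω * Real.exp (-h * t)) (Set.Ioi a) :=
    ⟨hm.aestronglyMeasurable,
      (hasFiniteIntegral_iff_ofReal (Eventually.of_forall hnn)).2 hfin⟩
  have heq : Set.EqOn (fun t : ℝ ↦ profitDiff κ₀ κ₁ θ (X t.toNNReal ω) * Real.exp (-ρ * t))
      (fun t ↦ (κ₁ - κ₀) * (discountedMoment X θ (ρ - h) t.toNNReal ω * Real.exp (-h * t)))
      (Set.Ioi a) := fun t ht ↦ profitDiff_mul_exp_eq hX κ₀ κ₁ θ ρ h (ha.trans ht.le)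
  refine ⟨(integrableOn_congr_fun heq measurableSet_Ioi).2 (hInt.const_mul _), ?_⟩
  rw [setIntegral_congr_fun measurableSet_Ioi heq, integral_const_mul,
    integral_eq_lintegral_of_nonneg_ae (Eventually.of_forall hnn) hm.aestronglyMeasurable]

/-! ### The performance criterion as an expected stopped gain. -/

theorem mainTheorem3 {Ω : Type*} [MeasurableSpace Ω] (P : Measure Ω) [IsProbabilityMeasure P]
    (pX pI : JumpDiffusionParams)
    (WX WI : ℝ≥0 → Ω → ℝ) (NX NI : ℝ≥0 → Ω → ℕ) (UX UI : ℕ → Ω → ℝ)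
    (noiseX : IsJumpDiffusionNoise pX WX NX UX P)
    (noiseI : IsJumpDiffusionNoise pI WI NI UI P)
    (x i : ℝ) (hx : 0 < x) (hi : 0 < i)
    (X I : ℝ≥0 → Ω → ℝ)
    (hX : X = jumpDiffusion pX x WX NX UX) (hI : I = jumpDiffusion pI i WI NI UI)
    (hXI : IndepFun (fun ω t ↦ X t ω) (fun ω t ↦ I t ω) P)
    (κ₀ κ₁ θ ρ n : ℝ) (hκ₀ : 0 < κ₀) (hκ : κ₀ < κ₁) (hθ : 0 < θ) (hn : 0 ≤ n)
    (hU : Integrable (fun ω ↦ (1 + UX 0 ω) ^ θ) P)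
    (h : ℝ) (h_def : h = effectiveRate P pX ρ θ (UX 0)) (h_pos : 0 < h)
    (τ : Ω → WithTop ℝ≥0)
    (hτ : IsStoppingTime
      (pairFiltration X I (fun t ↦ hX ▸ noiseX.measurable_jumpDiffusion x t)
        (fun t ↦ hI ▸ noiseI.measurable_jumpDiffusion i t)) τ) :
    -- the inner integral converges almost surely on `{τ < ∞}`
    (∀ᵐ ω ∂P, τ ω < ⊤ →
      IntegrableOn (fun t : ℝ ↦ profitDiff κ₀ κ₁ θ (X t.toNNReal ω) * Real.exp (-ρ * t))
        (Set.Ioi (((τ ω).untopA : ℝ) + n))) ∧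
    -- both expectations are well defined, with values in `[-∞, ∞)`
    AEMeasurable (investmentPayoff κ₀ κ₁ θ ρ n X I τ) P ∧
    AEMeasurable (stoppedGain κ₀ κ₁ θ ρ (constA h n) X I τ) P ∧
    (∫⁻ ω, ENNReal.ofReal (investmentPayoff κ₀ κ₁ θ ρ n X I τ ω) ∂P) < ⊤ ∧
    (∫⁻ ω, ENNReal.ofReal (stoppedGain κ₀ κ₁ θ ρ (constA h n) X I τ ω) ∂P) < ⊤ ∧
    -- and they are equal
    performanceCriterion P κ₀ κ₁ θ ρ n X I τ =
      extExpectation P (stoppedGain κ₀ κ₁ θ ρ (constA h n) X I τ) := by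
  have mX (t : ℝ≥0) : Measurable (X t) := hX ▸ noiseX.measurable_jumpDiffusion x t
  have mI (t : ℝ≥0) : Measurable (I t) := hI ▸ noiseI.measurable_jumpDiffusion i t
  have posX : ∀ᵐ ω ∂P, ∀ t, 0 < X t ω := hX ▸ noiseX.jumpDiffusion_pos hx
  have posI : ∀ᵐ ω ∂P, ∀ t, 0 < I t ω := hI ▸ noiseI.jumpDiffusion_pos hi
  have contX : ∀ᵐ ω ∂P, ∀ t, ContinuousWithinAt (fun s ↦ X s ω) (Set.Ici t) t :=
    hX ▸ noiseX.rightCont_jumpDiffusion x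
  have contI : ∀ᵐ ω ∂P, ∀ t, ContinuousWithinAt (fun s ↦ I s ω) (Set.Ici t) t :=
    hI ▸ noiseI.rightCont_jumpDiffusion i
  have hM := noiseX.martingale_discountedMoment hx hU hX mX mI hXI
  rw [momentRate_eq_sub_effectiveRate P pX ρ θ (UX 0), ← h_def] at hM
  have hM0 := discountedMoment_nonneg X θ (ρ - h)
  have contM : ∀ᵐ ω ∂P, ∀ t,
      ContinuousWithinAt (fun s ↦ discountedMoment X θ (ρ - h) s ω) (Set.Ici t) t := by
    filter_upwards [contX] with ω hω t using rightCont_discountedMoment hθ.le _ (hω t)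
  have mM (t : ℝ≥0) : Measurable (discountedMoment X θ (ρ - h) t) :=
    ((hM.1 t).mono (Filtration.le _ t)).measurable
  have hE := hτ.measurableSet_lt_top
  have hT : Measurable fun ω ↦ ((τ ω).untopA : ℝ) := hτ.measurable_untopA.coe_nnreal_real
  have hTn (ω : Ω) : 0 ≤ ((τ ω).untopA : ℝ) + n := add_nonneg (NNReal.coe_nonneg _) hn
  -- Where `τ = ⊤` the lower limit is a default value plus `n`, still nonnegative, so the finiteness
  -- bound holds on all of `Ω`; the indicators below discard these values.
  set F : Ω → ℝ≥0∞ := fun ω ↦ ∫⁻ t in Set.Ioi (((τ ω).untopA : ℝ) + n), ENNReal.ofReal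
    (discountedMoment X θ (ρ - h) t.toNNReal ω * Real.exp (-h * t)) with hF
  have mF : AEMeasurable F P := aemeasurable_lintegral_Ioi_of_rightCont mM contM (hT.add_const n) h
  have hFfin : ∫⁻ ω, F ω ∂P < ∞ := hM.lintegral_Ioi_lt_top hM0 contM hTn h_pos
  have hFae : ∀ᵐ ω ∂P, F ω < ∞ := ae_lt_top' mF hFfin.ne
  have hprofit : ∀ᵐ ω ∂P,
      IntegrableOn (fun t : ℝ ↦ profitDiff κ₀ κ₁ θ (X t.toNNReal ω) * Real.exp (-ρ * t))
        (Set.Ioi (((τ ω).untopA : ℝ) + n)) ∧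
      ∫ t in Set.Ioi (((τ ω).untopA : ℝ) + n),
        profitDiff κ₀ κ₁ θ (X t.toNNReal ω) * Real.exp (-ρ * t) = (κ₁ - κ₀) * (F ω).toReal := by
    filter_upwards [posX, ae_measurable_path_of_rightCont mX contX, hFae] with ω h1 h2 h3
    exact integrableOn_and_integral_profitDiff h1 h2 κ₀ κ₁ θ ρ h (hTn ω) h3
  set G : Ω → ℝ := fun ω ↦ stoppedValue (discountedMoment X θ (ρ - h)) τ ω
    * Real.exp (-h * (τ ω).untopA) * constA h n with hG
  have hG0 (ω : Ω) : 0 ≤ G ω :=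
    mul_nonneg (mul_nonneg (hM0 _ _) (Real.exp_pos _).le) (by unfold constA; positivity)
  have hFG : ∫⁻ ω in {ω | τ ω < ⊤}, F ω ∂P = ∫⁻ ω in {ω | τ ω < ⊤}, ENNReal.ofReal (G ω) ∂P :=
    hM.setLIntegral_Ioi_stopping hM0 contM hτ h_pos hn
  have hκ0 : 0 ≤ κ₁ - κ₀ := by linarith
  have mexp (c : ℝ) : Measurable fun ω ↦ Real.exp (c * ((τ ω).untopA : ℝ)) := by fun_prop
  -- The payoff is `a - c` and the stopped gain is `b - c`, almost surely; `a` and `b` have the same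
  -- finite expectation, while nothing is assumed about that of `c`.
  let a : Ω → ℝ := {ω | τ ω < ⊤}.indicator fun ω ↦ (κ₁ - κ₀) * (F ω).toReal
  let b : Ω → ℝ := {ω | τ ω < ⊤}.indicator fun ω ↦ (κ₁ - κ₀) * G ω
  let c : Ω → ℝ := {ω | τ ω < ⊤}.indicator fun ω ↦
    stoppedValue I τ ω * Real.exp (-ρ * (τ ω).untopA)
  have ha : ∀ᵐ ω ∂P, 0 ≤ a ω := Eventually.of_forall fun ω ↦
    Set.indicator_nonneg (fun ω _ ↦ mul_nonneg hκ0 ENNReal.toReal_nonneg) ω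
  have hb : ∀ᵐ ω ∂P, 0 ≤ b ω := Eventually.of_forall fun ω ↦
    Set.indicator_nonneg (fun ω _ ↦ mul_nonneg hκ0 (hG0 ω)) ω
  have hc : ∀ᵐ ω ∂P, 0 ≤ c ω := by
    filter_upwards [posI] with ω hω
    by_cases h : τ ω < ⊤
    · simp only [c]
      rw [Set.indicator_of_mem (by exact h)]
      exact mul_nonneg (hω _).le (Real.exp_pos _).le
    · simp only [c]
      rw [Set.indicator_of_notMem (by exact h)]
  have ham : AEMeasurable a P := (mF.ennreal_toReal.const_mul _).indicator hE
  have hbm : AEMeasurable b P :=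
    ((((aemeasurable_stoppedValue_of_rightCont hτ mM contM).mul (mexp _).aemeasurable).mul_const
      _).const_mul _).indicator hE
  have hcm : AEMeasurable c P :=
    ((aemeasurable_stoppedValue_of_rightCont hτ mI contI).mul (mexp _).aemeasurable).indicator hE
  have hinta : ∫⁻ ω, ENNReal.ofReal (a ω) ∂P
      = ENNReal.ofReal (κ₁ - κ₀) * ∫⁻ ω in {ω | τ ω < ⊤}, F ω ∂P := by
    rw [← lintegral_const_mul' _ _ ENNReal.ofReal_ne_top, ← lintegral_indicator hE]
    refine lintegral_congr_ae ?_
    filter_upwards [hFae] with ω hω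
    by_cases h : τ ω < ⊤
    · simp only [a]
      rw [Set.indicator_of_mem (by exact h), Set.indicator_of_mem (by exact h),
        ENNReal.ofReal_mul hκ0, ENNReal.ofReal_toReal hω.ne]
    · simp only [a]
      rw [Set.indicator_of_notMem (by exact h), Set.indicator_of_notMem (by exact h),
        ENNReal.ofReal_zero]
  have hintb : ∫⁻ ω, ENNReal.ofReal (b ω) ∂P
      = ENNReal.ofReal (κ₁ - κ₀) * ∫⁻ ω in {ω | τ ω < ⊤}, F ω ∂P := by
    rw [hFG, ← lintegral_const_mul' _ _ ENNReal.ofReal_ne_top, ← lintegral_indicator hE]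
    refine lintegral_congr fun ω ↦ ?_
    by_cases h : τ ω < ⊤
    · simp only [b]
      rw [Set.indicator_of_mem (by exact h), Set.indicator_of_mem (by exact h),
        ENNReal.ofReal_mul hκ0]
    · simp only [b]
      rw [Set.indicator_of_notMem (by exact h), Set.indicator_of_notMem (by exact h),
        ENNReal.ofReal_zero]
  have hfin : ENNReal.ofReal (κ₁ - κ₀) * ∫⁻ ω in {ω | τ ω < ⊤}, F ω ∂P < ∞ :=
    ENNReal.mul_lt_top ENNReal.ofReal_lt_top (lt_of_le_of_lt (setLIntegral_le_lintegral _ _) hFfin)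
  have hpay : investmentPayoff κ₀ κ₁ θ ρ n X I τ =ᵐ[P] fun ω ↦ a ω - c ω := by
    filter_upwards [hprofit] with ω hω
    simp only [investmentPayoff, a, c]
    by_cases h : τ ω < ⊤
    · rw [Set.indicator_of_mem (by exact h), Set.indicator_of_mem (by exact h),
        Set.indicator_of_mem (by exact h), hω.2]
    · rw [Set.indicator_of_notMem (by exact h), Set.indicator_of_notMem (by exact h),
        Set.indicator_of_notMem (by exact h), sub_zero]
  have hgain : stoppedGain κ₀ κ₁ θ ρ (constA h n) X I τ =ᵐ[P] fun ω ↦ b ω - c ω := by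
    filter_upwards [posX] with ω hω
    simp only [stoppedGain, b, c]
    by_cases h' : τ ω < ⊤
    · rw [Set.indicator_of_mem (by exact h'), Set.indicator_of_mem (by exact h'),
        Set.indicator_of_mem (by exact h')]
      exact exp_mul_gainFun_eq hω κ₀ κ₁ θ ρ h _ _
    · rw [Set.indicator_of_notMem (by exact h'), Set.indicator_of_notMem (by exact h'),
        Set.indicator_of_notMem (by exact h'), sub_zero]
  obtain ⟨hpm, hpfin, hpe⟩ := extExpectation_of_ae_eq_sub hpay ha hc ham hcm (hinta ▸ hfin)
  obtain ⟨hgm, hgfin, hge⟩ := extExpectation_of_ae_eq_sub hgain hb hc hbm hcm (hintb ▸ hfin)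
  refine ⟨hprofit.mono fun ω hω _ ↦ hω.1, hpm, hgm, hpfin, hgfin, ?_⟩
  rw [performanceCriterion, hpe, hge, hinta, hintb]
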